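/- Let $X\in\mathbb{R}^{N\times d}$ have rank $r$ and let $X=U\Sigma V^{T}$ be a thin singular value decomposition: $U\in\mathbb{R}^{N\times r}$ and $V\in\mathbb{R}^{d\times r}$ have orthonormal columns and $\Sigma=\mathrm{diag}(\sigma_1,\dots,\sigma_r)$ with $\sigma_1\ge\dots\ge\sigma_r>0$; put $\sigma_j=0$ for $j>r$. Let $1\le k\le r$ and let $V_k\in\mathbb{R}^{d\times k}$ consist of the first $k$ columns of $V$. The $k$-leverage score of $j\in[d]=\{1,\dots,d\}$ is $\ell^k_j=\sum_{i=1}^k V_{j,i}^2$. Let $S$ be a random subset of $[d]$ of size $k$ drawn from the projection DPP of marginal kernel $V_kV_k^{T}$, i.e. $\mathbb{P}_{\mathrm{DPP}}(S)=\det(V_{S,[k]})^2$ for $|S|=k$, where $V_{S,[k]}$ is the submatrix of $V_k$ of the rows indexed by $S$. Let $\|\cdot\|_2$ and $\|\cdot\|_{\mathrm{Fr}}$ be the spectral and Frobenius norms. For $\nu\in\{2,\mathrm{Fr}\}$, let $\Pi_S^{\nu}X$ be a minimizer of $\|X-A\|_\nu$ over the matrices $A=X_{:,S}B$ with $B\in\mathbb{R}^{k\times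 d}$, and let $\Pi_kX$ be a best approximation of $X$ of rank at most $k$ in the norm $\|\cdot\|_\nu$ under consideration. Let $$\beta=\sigma_{k+1}^2\Big(\frac1{d-k}\sum_{j\ge k+1}\sigma_j^2\Big)^{-1}.$$ **Theorem.** Let $\pi$ be a permutation of $[d]$ with $\ell^k_{\pi_1}\ge\ell^k_{\pi_2}\ge\dots\ge\ell^k_{\pi_d}$. Let $\theta>1$, $$p_{\mathrm{eff}}(\theta)=\min\Big\{q\in[d]:\ \sum_{i\le q}\ell^k_{\pi_i}\ \ge\ k-1+\frac1\theta\Big\},$$ and let $\mathcal{A}_\theta$ be the event that $S\cap\{\pi_i:\ p_{\mathrm{eff}}(\theta)<i\le d\}=\emptyset$. Then $$\mathbb{P}_{\mathrm{DPP}}(\mathcal{A}_\theta)\ \ge\ \frac1\theta,$$ $$\mathbb{E}_{\mathrm{DPP}}\big[\|X-\Pi_S^{2}X\|_2^2\,\big|\,\mathcal{A}_\theta\big]\ \le\ (p_{\mathrm{eff}}(\theta)-k+1)(k-1+\theta)\,\|X-\Pi_kX\|_2^2,$$ $$\mathbb{E}_{\mathrm{DPP}}\big[\|X-\Pi_S^{\mathrm{Fr}}X\|_{\mathrm{Fr}}^2\,\big|\,\mathcal{A}_\theta\big]\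 \le\ \Big(1+\beta\,\frac{p_{\mathrm{eff}}(\theta)+1-k}{d-k}\,(k-1+\theta)\Big)\|X-\Pi_kX\|_{\mathrm{Fr}}^2.$$ In the degenerate case $r=k$, where $\sigma_{k+1}=0$ and $\beta$ is a quotient $0/0$, the term containing $\beta$ is read as $0$ (both sides of the last bound are then $0$). -/

import Mathlib

open MeasureTheory
open scoped Matrix

noncomputable section

namespace ColumnSubset

/-- Thin singular value decomposition `X = U Σ Vᵀ`: `U` and `V` have orthonormal columns and the
singular values `σ 0 ≥ σ 1 ≥ ... ≥ σ (r - 1)` are positive, so that `r` is the rank of `X`. -/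
structure IsThinSVD {N d r : ℕ} (X : Matrix (Fin N) (Fin d) ℝ) (U : Matrix (Fin N) (Fin r) ℝ)
    (σ : Fin r → ℝ) (V : Matrix (Fin d) (Fin r) ℝ) : Prop where
  orthU : Uᵀ * U = 1
  orthV : Vᵀ * V = 1
  pos : ∀ i, 0 < σ i
  anti : Antitone σ
  eq : X = U * Matrix.diagonal σ * Vᵀ

/-- The first `k` columns of a matrix with `r ≥ k` columns. -/
def firstCols {d r k : ℕ} (hk : k ≤ r) (V : Matrix (Fin d) (Fin r) ℝ) :
    Matrix (Fin d) (Fin k) ℝ :=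
  V.submatrix id (Fin.castLE hk)

/-- The two matrix norms under consideration. -/
inductive NormKind
  | spectral
  | frobenius

open scoped Matrix.Norms.L2Operator in
/-- The spectral norm: the operator norm between Euclidean spaces. -/
def spectralNorm {N d : ℕ} (A : Matrix (Fin N) (Fin d) ℝ) : ℝ := ‖A‖

open scoped Matrix.Norms.Frobenius in
/-- The Frobenius norm. -/
def frobeniusNorm {N d : ℕ} (A : Matrix (Fin N) (Fin d) ℝ) : ℝ := ‖A‖

/-- The norm `‖A‖_ν`. -/
def matNorm {N d : ℕ} (ν : NormKind) (A : Matrix (Fin N) (Fin d) ℝ) : ℝ :=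
  match ν with
  | .spectral => spectralNorm A
  | .frobenius => frobeniusNorm A

/-- `A` is a point of `C` that is closest to `X` in the norm `‖·‖_ν`. -/
def IsNearest {N d : ℕ} (ν : NormKind) (C : Set (Matrix (Fin N) (Fin d) ℝ))
    (X A : Matrix (Fin N) (Fin d) ℝ) : Prop :=
  A ∈ C ∧ ∀ B ∈ C, matNorm ν (X - A) ≤ matNorm ν (X - B)

theorem exists_nearest_aux {E : Type*} [NormedAddCommGroup E] [NormedSpace ℝ E]
    [FiniteDimensional ℝ E] {C : Set E} (hC : IsClosed C) (hne : C.Nonempty) (x : E) :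
    ∃ a ∈ C, ∀ b ∈ C, ‖x - a‖ ≤ ‖x - b‖ := by
  have : ProperSpace E := FiniteDimensional.proper ℝ E
  obtain ⟨a, ha, h⟩ := hC.exists_infDist_eq_dist hne x
  refine ⟨a, ha, fun b hb => ?_⟩
  rw [← dist_eq_norm, ← dist_eq_norm, ← h]
  exact Metric.infDist_le_dist_of_mem hb

theorem exists_isNearest {N d : ℕ} (ν : NormKind) {C : Set (Matrix (Fin N) (Fin d) ℝ)}
    (hC : IsClosed C) (hne : C.Nonempty) (X : Matrix (Fin N) (Fin d) ℝ) :
    ∃ A, IsNearest ν C X A := by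
  cases ν with
  | spectral =>
    open scoped Matrix.Norms.L2Operator in
    obtain ⟨a, ha, h⟩ := exists_nearest_aux hC hne X
    exact ⟨a, ha, h⟩
  | frobenius =>
    open scoped Matrix.Norms.Frobenius in
    obtain ⟨a, ha, h⟩ := exists_nearest_aux hC hne X
    exact ⟨a, ha, h⟩

/-- The matrices of rank at most `k`. -/
def rankLE (N d k : ℕ) : Set (Matrix (Fin N) (Fin d) ℝ) := {A | A.rank ≤ k}

/-- The matrices whose columns lie in the span of the columns of `X` indexed by `S`, that is the
matrices `X_{:,S} B`. When `S` has `k` elements they automatically have rank at most `k`. -/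
def colSpan {N d : ℕ} (X : Matrix (Fin N) (Fin d) ℝ) (S : Finset (Fin d)) :
    Set (Matrix (Fin N) (Fin d) ℝ) :=
  Set.range fun B : Matrix S (Fin d) ℝ => X.submatrix id (Subtype.val : S → Fin d) * B

theorem isClosed_rankLE (N d k : ℕ) : IsClosed (rankLE N d k) := by
  have h := (isOpen_setOfPred_nat_le_rank (𝕜 := ℝ) (E := Fin d → ℝ) (F := Fin N → ℝ)
    (k + 1)).isClosed_compl
  have hc : Continuous fun A : Matrix (Fin N) (Fin d) ℝ =>
      LinearMap.toContinuousLinearMap (Matrix.toLin' A) :=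
    ((Matrix.toLin' (R := ℝ) (m := Fin N) (n := Fin d)).trans
      LinearMap.toContinuousLinearMap).toLinearMap.continuous_of_finiteDimensional
  convert h.preimage hc using 1
  ext A
  have hA : LinearMap.rank (Matrix.toLin' A) = (A.rank : Cardinal) := by
    rw [Matrix.rank, ← Matrix.toLin'_apply', LinearMap.rank, Module.finrank_eq_rank]
  change A.rank ≤ k ↔ ¬ (((k + 1 : ℕ) : Cardinal) ≤ LinearMap.rank (Matrix.toLin' A))
  rw [hA, Nat.cast_le]
  omega

theorem exists_bestRank {N d : ℕ} (ν : NormKind) (k : ℕ) (X : Matrix (Fin N) (Fin d) ℝ) :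
    ∃ A, IsNearest ν (rankLE N d k) X A :=
  exists_isNearest ν (isClosed_rankLE N d k) ⟨0, by simp [rankLE]⟩ X

theorem exists_colProj {N d : ℕ} (ν : NormKind) (X : Matrix (Fin N) (Fin d) ℝ)
    (S : Finset (Fin d)) : ∃ A, IsNearest ν (colSpan X S) X A := by
  refine exists_isNearest ν ?_ (Set.range_nonempty _) X
  exact (LinearMap.range (mulLeftLinearMap (Fin d) ℝ
    (X.submatrix id (Subtype.val : S → Fin d)))).closed_of_finiteDimensional

/-- `Π_k X`: a best approximation of `X` of rank at most `k` in the norm `‖·‖_ν`. -/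
def bestRank {N d : ℕ} (ν : NormKind) (k : ℕ) (X : Matrix (Fin N) (Fin d) ℝ) :
    Matrix (Fin N) (Fin d) ℝ :=
  (exists_bestRank ν k X).choose

/-- `Π_S^ν X`: a best approximation of `X` in the norm `‖·‖_ν` among the matrices whose columns
lie in the span of the columns of `X` indexed by `S`. -/
def colProj {N d : ℕ} (ν : NormKind) (X : Matrix (Fin N) (Fin d) ℝ) (S : Finset (Fin d)) :
    Matrix (Fin N) (Fin d) ℝ :=
  (exists_colProj ν X S).choose

/-- `Det(V_{S,[k]})²` if `S` has `k` elements, and `0` otherwise. -/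
def dppWeight {d k : ℕ} (Vk : Matrix (Fin d) (Fin k) ℝ) (S : Finset (Fin d)) : ℝ :=
  if h : S.card = k then (Vk.submatrix (S.orderEmbOfFin h) id).det ^ 2 else 0

/-- The law of the random set of column indices: `S` has probability `Det(V_{S,[k]})²` if
`|S| = k`, and `0` otherwise. -/
def dpp {d k : ℕ} (Vk : Matrix (Fin d) (Fin k) ℝ) : Measure (Finset (Fin d)) :=
  ∑ S : Finset (Fin d), ENNReal.ofReal (dppWeight Vk S) • Measure.dirac S

theorem dppWeight_nonneg {d k : ℕ} (Vk : Matrix (Fin d) (Fin k) ℝ) (S : Finset (Fin d)) :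
    0 ≤ dppWeight Vk S := by
  unfold dppWeight
  split_ifs
  · positivity
  · exact le_rfl

/-- The weights sum to `Det(Vₖᵀ Vₖ)`. -/
theorem sum_dppWeight {d k : ℕ} (Vk : Matrix (Fin d) (Fin k) ℝ) :
    ∑ S : Finset (Fin d), dppWeight Vk S = (Vkᵀ * Vk).det := by
  have h1 : (Vkᵀ * Vk).det =
      ∑ f : Fin k → Fin d, (∏ i, Vk (f i) i) * (Vk.submatrix f id).det := by
    rw [← Matrix.det_transpose, Matrix.det_apply']
    simp only [Matrix.transpose_apply, Matrix.mul_apply, Finset.prod_univ_sum,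
      Fintype.piFinset_univ, Finset.mul_sum]
    rw [Finset.sum_comm]
    refine Finset.sum_congr rfl fun f _ => ?_
    rw [← Matrix.det_transpose, Matrix.det_apply', Finset.mul_sum]
    refine Finset.sum_congr rfl fun τ _ => ?_
    simp only [Finset.prod_mul_distrib, Matrix.transpose_apply, Matrix.submatrix_apply, id]
    ring
  rw [h1]
  have h2 : ∑ S : Finset (Fin d), dppWeight Vk S =
      ∑ S : {S : Finset (Fin d) // S.card = k}, dppWeight Vk S.1 := by
    symm
    refine Fintype.sum_of_injective (fun S => S.1) Subtype.val_injective _ _ ?_ fun _ => rfl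
    intro S hS
    unfold dppWeight
    rw [dif_neg]
    exact fun h => hS ⟨⟨S, h⟩, rfl⟩
  have h3 : ∀ S : {S : Finset (Fin d) // S.card = k}, dppWeight Vk S.1 =
      ∑ τ : Equiv.Perm (Fin k), (∏ i, Vk (S.1.orderEmbOfFin S.2 (τ i)) i) *
        (Vk.submatrix (fun i => S.1.orderEmbOfFin S.2 (τ i)) id).det := by
    intro S
    have h4 : ∀ τ : Equiv.Perm (Fin k),
        (Vk.submatrix (fun i => S.1.orderEmbOfFin S.2 (τ i)) id).det =
          (Equiv.Perm.sign τ : ℤ) * (Vk.submatrix (S.1.orderEmbOfFin S.2) id).det := by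
      intro τ
      rw [← Matrix.det_permute]
      rfl
    simp only [h4]
    rw [dppWeight, dif_pos S.2, sq]
    nth_rewrite 1 [Matrix.det_apply']
    rw [Finset.sum_mul]
    refine Finset.sum_congr rfl fun τ _ => ?_
    simp only [Matrix.submatrix_apply, id]
    ring
  rw [h2, Finset.sum_congr rfl fun S _ => h3 S, ← Fintype.sum_prod_type'
    (f := fun (S : {S : Finset (Fin d) // S.card = k}) (τ : Equiv.Perm (Fin k)) =>
      (∏ i, Vk (S.1.orderEmbOfFin S.2 (τ i)) i) *
        (Vk.submatrix (fun i => S.1.orderEmbOfFin S.2 (τ i)) id).det)]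
  refine Fintype.sum_of_injective
    (fun p : {S : Finset (Fin d) // S.card = k} × Equiv.Perm (Fin k) =>
      fun i => p.1.1.orderEmbOfFin p.1.2 (p.2 i)) ?_ _ _ ?_ fun _ => rfl
  · rintro ⟨S, τ⟩ ⟨S', τ'⟩ h
    have hr : ∀ (T : {S : Finset (Fin d) // S.card = k}) (ρ : Equiv.Perm (Fin k)),
        Set.range (fun i => T.1.orderEmbOfFin T.2 (ρ i)) = (T.1 : Set (Fin d)) := by
      intro T ρ
      rw [← Finset.range_orderEmbOfFin T.1 T.2]
      exact ρ.surjective.range_comp (T.1.orderEmbOfFin T.2)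
    have hS : S = S' := by
      apply Subtype.ext
      apply Finset.coe_injective
      rw [← hr S τ, ← hr S' τ']
      exact congrArg Set.range h
    subst hS
    refine Prod.ext rfl (Equiv.ext fun i => ?_)
    exact (S.1.orderEmbOfFin S.2).injective (congrFun h i)
  · intro f hf
    by_cases hinj : Function.Injective f
    · exfalso
      apply hf
      have hcard : (Finset.univ.image f).card = k := by
        rw [Finset.card_image_of_injective _ hinj, Finset.card_univ, Fintype.card_fin]
      have hmem : ∀ i, f i ∈ Finset.univ.image f :=
        fun i => Finset.mem_image_of_mem f (Finset.mem_univ i)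
      let g : Fin k → Fin k :=
        fun i => ((Finset.univ.image f).orderIsoOfFin hcard).symm ⟨f i, hmem i⟩
      have hg : ∀ i, (Finset.univ.image f).orderEmbOfFin hcard (g i) = f i := by
        intro i
        rw [← Finset.coe_orderIsoOfFin_apply]
        simp [g]
      have hginj : Function.Injective g := by
        intro i j hij
        apply hinj
        rw [← hg i, ← hg j, hij]
      refine ⟨(⟨_, hcard⟩, Equiv.ofBijective g (Finite.injective_iff_bijective.1 hginj)), ?_⟩
      funext i
      exact hg i
    · simp only [Function.Injective, not_forall] at hinj
      obtain ⟨i, j, hij, hne⟩ := hinj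
      rw [Matrix.det_zero_of_row_eq hne, mul_zero]
      funext l
      simp [hij]

theorem isProbabilityMeasure_dpp {d k : ℕ} {Vk : Matrix (Fin d) (Fin k) ℝ} (h : Vkᵀ * Vk = 1) :
    IsProbabilityMeasure (dpp Vk) := by
  constructor
  simp only [dpp, Measure.coe_finsetSum, Finset.sum_apply, Measure.smul_apply, measure_univ,
    smul_eq_mul, mul_one]
  rw [← ENNReal.ofReal_sum_of_nonneg fun S _ => dppWeight_nonneg Vk S, sum_dppWeight, h]
  simp

theorem firstCols_orth {d r k : ℕ} (hk : k ≤ r) {V : Matrix (Fin d) (Fin r) ℝ}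
    (h : Vᵀ * V = 1) : (firstCols hk V)ᵀ * firstCols hk V = 1 := by
  ext i j
  have := congrFun (congrFun h (Fin.castLE hk i)) (Fin.castLE hk j)
  simpa [firstCols, Matrix.mul_apply, Matrix.one_apply] using this

/-- The `k`-leverage score of the `j`-th column: the squared norm of the `j`-th row of `Vₖ`. -/
def leverage {d k : ℕ} (Vk : Matrix (Fin d) (Fin k) ℝ) (j : Fin d) : ℝ :=
  ∑ i : Fin k, Vk j i ^ 2

/-- The effective sparsity level: the least `q ∈ {1, ..., d}` such that the first `q` leverage
scores, in the order given by `π`, sum to at least `k - 1 + 1/θ`. -/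
def pEff {d k : ℕ} (Vk : Matrix (Fin d) (Fin k) ℝ) (π : Equiv.Perm (Fin d)) (θ : ℝ) : ℕ :=
  sInf {q : ℕ | 1 ≤ q ∧ q ≤ d ∧
    (k : ℝ) - 1 + 1 / θ ≤ ∑ i : Fin d with i.val < q, leverage Vk (π i)}

/-- The indices that come after the first `q` ones in the order given by `π`. -/
def tailSet {d : ℕ} (π : Equiv.Perm (Fin d)) (q : ℕ) : Finset (Fin d) :=
  (Finset.univ.filter fun i : Fin d => q ≤ i.val).image π

/-- The event that `S` contains none of the indices that come after the first `p_eff(θ)` ones. -/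
def avoidEvent {d k : ℕ} (Vk : Matrix (Fin d) (Fin k) ℝ) (π : Equiv.Perm (Fin d)) (θ : ℝ) :
    Set (Finset (Fin d)) :=
  {S | S ∩ tailSet π (pEff Vk π θ) = ∅}

/-- The flatness parameter `β = σ_{k+1}² ((1/(d-k)) ∑_{j ≥ k+1} σ_j²)⁻¹` of the singular values
`σ_1 ≥ ... ≥ σ_r`, here `σ 0, ..., σ (r - 1)`, where `σ_j = 0` for `j > r`. If `σ_{k+1} = 0`,
then it takes the value `0`. -/
def flatness {r : ℕ} (d k : ℕ) (σ : Fin r → ℝ) : ℝ :=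
  (if h : k < r then σ ⟨k, h⟩ ^ 2 else 0) *
    (1 / ((d : ℝ) - k) * ∑ j : Fin r with k ≤ j.val, σ j ^ 2)⁻¹

end ColumnSubset

end

open ColumnSubset

/-! Write `V` for the first `k` right singular vectors and `E = X - X V Vᵀ`, so that `E V = 0`. If
the square matrix `W` of the rows of `V` in `S` is invertible, there is a `C` supported on the rows
in `S` with `Vᵀ C = 1`. The competitor `X C Vᵀ` lies in the span of the selected columns and leaves
the error `E - E C Vᵀ`. Orthogonality bounds its square by `‖E‖₂² ‖C‖²` in spectral norm and by
`‖E‖² + ‖E‖₂² ‖C‖²` in Frobenius norm, with `‖C‖ = ‖W⁻¹‖` Frobenius norms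
(`spectralNorm_residual_sq_le`, `frobeniusNorm_residual_sq_le`).

The weight `det W ^ 2` turns `‖W⁻¹‖²` into the sum of the squared entries of `adj W`. Let `A` be the
set of the first `p` indices and `G` the Gram matrix of the rows of `V` in `A`. The event is `S ⊆
A`; by Cauchy-Binet its probability is `det G`. A minor omits one row, which can be restored inside
`A` in `p - k + 1` ways, so summing over `S ⊆ A` gives `(p - k + 1) tr (adj G)`
(`sum_injective_adjugate_sq`).

The eigenvalues `λ` of `G` lie in `[0, 1]` and sum to at least `k - 1 + 1/θ`. Hence `det G ≥ 1/θ`,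
each `λ ≥ 1/θ`, and `tr (adj G) / det G = ∑ 1/λ ≤ ∑ (1 + θ (1 - λ)) ≤ k - 1 + θ`
(`det_and_trace_adjugate_bound`). The Eckart-Young bounds compare `E` with a best approximation of
rank at most `k`, and the definition of `β` converts `σ_{k+1}²` into a multiple of the squared tail.
-/

namespace ColumnSubset

/-! ### Cauchy-Binet identities for determinants and adjugates, over sequences of rows. -/

section Combinatorics

variable {n ι : Type*} [Fintype n] [DecidableEq n] [Fintype ι]

theorem det_sum_smul_rows (c : n → ι → ℝ) (b : n → ι → n → ℝ) :
    (Matrix.of fun i j => ∑ x, c i x * b i x j).det =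
      ∑ f : n → ι, (∏ i, c i (f i)) * (Matrix.of fun i => b i (f i)).det := by
  classical
  have h : (Matrix.of fun i j => ∑ x, c i x * b i x j) =
      (fun i => ∑ x, c i x • b i x : n → n → ℝ) := by
    ext i j
    simp [Finset.sum_apply]
  have h2 := (Matrix.detRowAlternating (n := n) (R := ℝ)).toMultilinearMap.map_sum
    (fun i x => c i x • b i x)
  rw [h]
  refine Eq.trans h2 (Finset.sum_congr rfl fun f _ => ?_)
  exact (Matrix.detRowAlternating (n := n) (R := ℝ)).toMultilinearMap.map_smul_univ
    (fun i => c i (f i)) (fun i => b i (f i))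

theorem sign_mul_sign_self (τ : Equiv.Perm n) :
    ((Equiv.Perm.sign τ : ℤ) : ℝ) * ((Equiv.Perm.sign τ : ℤ) : ℝ) = 1 := by
  rcases Int.units_eq_one_or (Equiv.Perm.sign τ) with h | h <;> simp [h]

theorem sum_sum_sum_rotate {α β γ : Type*} [Fintype α] [Fintype β] [Fintype γ]
    (F : α → β → γ → ℝ) : ∑ a, ∑ b, ∑ c, F a b c = ∑ b, ∑ c, ∑ a, F a b c := by
  rw [Finset.sum_comm]
  exact Finset.sum_congr rfl fun b _ => Finset.sum_comm

/-- Leibniz expansion of the first determinant supplies the coefficients for the multilinear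
expansion of the second. The families depend on the row `i` so that a single row can later be
replaced by a unit vector. -/
theorem sum_det_mul_det (a b : n → ι → n → ℝ) :
    ∑ f : n → ι, (Matrix.of fun i => a i (f i)).det * (Matrix.of fun i => b i (f i)).det =
      ∑ τ : Equiv.Perm n, ((Equiv.Perm.sign τ : ℤ) : ℝ) *
        (Matrix.of fun i j => ∑ x, a i x (τ i) * b i x j).det := by
  simp_rw [det_sum_smul_rows (fun i x => a i x _) b, Finset.mul_sum]
  rw [Finset.sum_comm]
  refine Finset.sum_congr rfl fun f _ => ?_
  rw [← Matrix.det_transpose, Matrix.det_apply', Finset.sum_mul]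
  refine Finset.sum_congr rfl fun τ _ => ?_
  simp [mul_assoc]

/-- The Cauchy-Binet formula for a Gram matrix, as a sum over all sequences of rows. -/
theorem sum_det_submatrix_sq (B : Matrix ι n ℝ) :
    ∑ f : n → ι, (B.submatrix f id).det ^ 2 = (Fintype.card n).factorial * (Bᵀ * B).det := by
  have h := sum_det_mul_det (fun (_ : n) x => B x) (fun (_ : n) x => B x)
  have h2 : ∀ τ : Equiv.Perm n, ((Equiv.Perm.sign τ : ℤ) : ℝ) *
      (Matrix.of fun i j => ∑ x, B x (τ i) * B x j).det = (Bᵀ * B).det := by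
    intro τ
    have : (Matrix.of fun i j => ∑ x, B x (τ i) * B x j) = (Bᵀ * B).submatrix τ id := by
      ext i j
      simp [Matrix.mul_apply]
    rw [this, Matrix.det_permute, ← mul_assoc, sign_mul_sign_self, one_mul]
  rw [Finset.sum_congr rfl fun τ _ => h2 τ, Finset.sum_const, Finset.card_univ,
    Fintype.card_perm, nsmul_eq_mul] at h
  rw [← h]
  refine Finset.sum_congr rfl fun f _ => ?_
  rw [sq]
  rfl

/-- An adjugate entry is the determinant with row `j` replaced by a unit vector, so it does not
depend on `f j`; summing over this free index produces the factor `Fintype.card ι`. -/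
theorem sum_adjugate_sq_aux (B : Matrix ι n ℝ) (j l : n) :
    ∑ f : n → ι, (B.submatrix f id).adjugate l j ^ 2 =
      Fintype.card ι * ∑ τ : Equiv.Perm n, if τ j = l then (Bᵀ * B).adjugate l l else 0 := by
  have h := sum_det_mul_det
    (fun (i : n) x => if i = j then Pi.single l (1 : ℝ) else B x)
    (fun (i : n) x => if i = j then Pi.single l (1 : ℝ) else B x)
  have hrow : ∀ f : n → ι, (Matrix.of fun i => if i = j then Pi.single l (1 : ℝ) else B (f i)) =
      (B.submatrix f id).updateRow j (Pi.single l 1) := by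
    intro f
    ext i m
    by_cases hi : i = j
    · subst hi; simp
    · simp [hi]
  simp_rw [hrow, ← Matrix.adjugate_apply, ← sq] at h
  rw [h, Finset.mul_sum]
  refine Finset.sum_congr rfl fun τ _ => ?_
  by_cases hτ : τ j = l
  -- This is the Gram matrix with row `l` replaced by a unit vector and its rows permuted by `τ`,
  -- except that row `j`, which `τ` sends to `l`, carries the factor `Fintype.card ι`.
  · have : (Matrix.of fun i m => ∑ x : ι, (if i = j then Pi.single l (1 : ℝ) else B x) (τ i) *
        (if i = j then Pi.single l (1 : ℝ) else B x) m) =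
        (((Bᵀ * B).updateRow l (Pi.single l (1 : ℝ))).submatrix τ id).updateRow j
          ((Fintype.card ι : ℝ) • Pi.single l (1 : ℝ)) := by
      ext i m
      by_cases hi : i = j
      · subst hi; simp [hτ]
      · have hi' : τ i ≠ l := fun h => hi (τ.injective (h.trans hτ.symm))
        simp [hi, hi', Matrix.mul_apply]
    rw [this, Matrix.det_updateRow_smul, if_pos hτ]
    have h3 : (((Bᵀ * B).updateRow l (Pi.single l (1 : ℝ))).submatrix τ id).updateRow j
          (Pi.single l (1 : ℝ)) = ((Bᵀ * B).updateRow l (Pi.single l (1 : ℝ))).submatrix τ id := by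
      ext i m
      by_cases hi : i = j
      · subst hi; simp [hτ]
      · simp [hi]
    rw [h3, Matrix.det_permute, Matrix.adjugate_apply]
    linear_combination ((Fintype.card ι : ℝ) *
      ((Bᵀ * B).updateRow l (Pi.single l (1 : ℝ))).det) * sign_mul_sign_self τ
  · rw [if_neg hτ, mul_zero, Matrix.det_eq_zero_of_row_eq_zero j, mul_zero]
    intro m
    simp [hτ]

theorem sum_sum_adjugate_sq (B : Matrix ι n ℝ) :
    ∑ f : n → ι, ∑ j, ∑ l, (B.submatrix f id).adjugate l j ^ 2 =
      Fintype.card ι * ((Fintype.card n).factorial * (Bᵀ * B).adjugate.trace) := by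
  simp_rw [sum_sum_sum_rotate (fun (f : n → ι) j l => (B.submatrix f id).adjugate l j ^ 2),
    sum_adjugate_sq_aux, ← Finset.mul_sum]
  congr 1
  rw [← sum_sum_sum_rotate (fun (τ : Equiv.Perm n) j l =>
    if τ j = l then (Bᵀ * B).adjugate l l else 0)]
  have : ∀ τ : Equiv.Perm n, ∑ j, ∑ l, (if τ j = l then (Bᵀ * B).adjugate l l else 0) =
      (Bᵀ * B).adjugate.trace := by
    intro τ
    simp only [Finset.sum_ite_eq, Finset.mem_univ, if_true]
    exact Equiv.sum_comp τ (fun l => (Bᵀ * B).adjugate l l)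
  rw [Finset.sum_congr rfl fun τ _ => this τ]
  simp [Fintype.card_perm]

/-- Exchanging `f j` with `y` is an involution on the pairs `(f, y)`. -/
theorem sum_sum_update [DecidableEq ι] (j : n) (F : (n → ι) → ℝ) :
    ∑ f : n → ι, ∑ y, F (Function.update f j y) = Fintype.card ι * ∑ f, F f := by
  rw [← Fintype.sum_prod_type' (f := fun f y => F (Function.update f j y))]
  let e : (n → ι) × ι → (n → ι) × ι := fun p => (Function.update p.1 j p.2, p.1 j)
  have he : Function.Involutive e := by
    rintro ⟨f, y⟩
    simp [e]
  rw [Fintype.sum_equiv he.toPerm (fun p => F (Function.update p.1 j p.2)) (fun p => F p.1)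
    (fun p => rfl), Fintype.sum_prod_type]
  simp [Finset.mul_sum]

theorem card_update_injective [DecidableEq ι] (j : n) (f : n → ι)
    (hf : Set.InjOn f {i | i ≠ j}) :
    ((Finset.univ.filter fun y => Function.Injective (Function.update f j y)).card : ℝ) =
      Fintype.card ι - Fintype.card n + 1 := by
  have h : (Finset.univ.filter fun y => Function.Injective (Function.update f j y)) =
      ((Finset.univ.erase j).image f)ᶜ := by
    ext y
    simp only [Finset.mem_filter, Finset.mem_univ, true_and, Finset.mem_compl, Finset.mem_image,
      Finset.mem_erase, and_true, not_exists, not_and]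
    constructor
    · intro hy i hi h
      apply hi
      apply hy
      simp [hi, h]
    · intro hy a b hab
      by_cases ha : a = j <;> by_cases hb : b = j
      · rw [ha, hb]
      · subst ha
        exact absurd (by simpa [hb] using hab.symm) (hy b hb)
      · subst hb
        exact absurd (by simpa [ha] using hab) (hy a ha)
      · exact hf ha hb (by simpa [ha, hb] using hab)
  have hc : ((Finset.univ.erase j).image f).card + 1 = Fintype.card n := by
    rw [Finset.card_image_of_injOn (by simpa [Set.InjOn] using hf),
      Finset.card_erase_add_one (Finset.mem_univ j), Finset.card_univ]
  have hc2 := Finset.card_add_card_compl ((Finset.univ.erase j).image f)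
  rw [h, ← hc, ← hc2]
  push_cast
  ring

/-- Resample the index `f j`, which the entry ignores. If the other indices are distinct, all values
but `Fintype.card n - 1` keep the sequence injective; if they repeat, the entry vanishes. -/
theorem sum_injective_adjugate_sq_aux [DecidableEq ι] (B : Matrix ι n ℝ) (j l : n) :
    Fintype.card ι * ∑ f : n → ι, (if Function.Injective f then
        (B.submatrix f id).adjugate l j ^ 2 else 0) =
      ((Fintype.card ι : ℝ) - Fintype.card n + 1) *
        ∑ f : n → ι, (B.submatrix f id).adjugate l j ^ 2 := by
  rw [← sum_sum_update j, Finset.mul_sum]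
  refine Finset.sum_congr rfl fun f _ => ?_
  have hu : ∀ y, (B.submatrix (Function.update f j y) id).adjugate l j =
      (B.submatrix f id).adjugate l j := by
    intro y
    rw [Matrix.adjugate_apply, Matrix.adjugate_apply]
    congr 1
    ext i m
    by_cases hi : i = j
    · subst hi; simp
    · simp [hi]
  simp_rw [hu]
  by_cases hf : Set.InjOn f {i | i ≠ j}
  · rw [← Finset.sum_filter, Finset.sum_const, nsmul_eq_mul, card_update_injective j f hf]
  · have h0 : (B.submatrix f id).adjugate l j = 0 := by
      simp only [Set.InjOn, not_forall] at hf
      obtain ⟨a, ha, b, hb, hab, hne⟩ := hf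
      rw [Matrix.adjugate_apply]
      refine Matrix.det_zero_of_row_eq hne ?_
      rw [Matrix.updateRow_ne ha, Matrix.updateRow_ne hb]
      funext m
      simp [hab]
    simp [h0]

/-- This is the source of the factor `p_eff - k + 1`: without injectivity the factor would be
`Fintype.card ι`. -/
theorem sum_injective_adjugate_sq [DecidableEq ι] [Nonempty ι] (B : Matrix ι n ℝ) :
    ∑ f : n → ι, (if Function.Injective f then
        ∑ j, ∑ l, (B.submatrix f id).adjugate l j ^ 2 else 0) =
      (Fintype.card n).factorial *
        (((Fintype.card ι : ℝ) - Fintype.card n + 1) * (Bᵀ * B).adjugate.trace) := by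
  have hp : (Fintype.card ι : ℝ) ≠ 0 := by
    exact_mod_cast Fintype.card_ne_zero
  apply mul_left_cancel₀ hp
  have h1 : ∀ f : n → ι, (if Function.Injective f then
      ∑ j, ∑ l, (B.submatrix f id).adjugate l j ^ 2 else 0) =
      ∑ j, ∑ l, if Function.Injective f then (B.submatrix f id).adjugate l j ^ 2 else 0 := by
    intro f
    split_ifs <;> simp
  have h2 := sum_sum_adjugate_sq B
  rw [sum_sum_sum_rotate] at h2
  rw [Finset.sum_congr rfl fun f _ => h1 f, sum_sum_sum_rotate, Finset.mul_sum]
  simp_rw [Finset.mul_sum (Finset.univ : Finset n), sum_injective_adjugate_sq_aux,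
    ← Finset.mul_sum]
  rw [h2]
  ring

end Combinatorics

/-! ### From random subsets to sequences of indices. -/

/-- Sums against the weights of the determinantal process, as sums over sequences of indices. -/
theorem factorial_mul_sum_dppWeight {d k : ℕ} (Vk : Matrix (Fin d) (Fin k) ℝ)
    (φ : Finset (Fin d) → ℝ) :
    (k.factorial : ℝ) * ∑ S, dppWeight Vk S * φ S =
      ∑ f : Fin k → Fin d, (Vk.submatrix f id).det ^ 2 * φ (Finset.univ.image f) := by
  have h2 : ∑ S : Finset (Fin d), dppWeight Vk S * φ S =
      ∑ S : {S : Finset (Fin d) // S.card = k}, dppWeight Vk S.1 * φ S.1 := by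
    symm
    refine Fintype.sum_of_injective (fun S => S.1) Subtype.val_injective _ _ ?_ fun _ => rfl
    intro S hS
    unfold dppWeight
    rw [dif_neg, zero_mul]
    exact fun h => hS ⟨⟨S, h⟩, rfl⟩
  have hr : ∀ (T : {S : Finset (Fin d) // S.card = k}) (ρ : Equiv.Perm (Fin k)),
      Set.range (fun i => T.1.orderEmbOfFin T.2 (ρ i)) = (T.1 : Set (Fin d)) := by
    intro T ρ
    rw [← Finset.range_orderEmbOfFin T.1 T.2]
    exact ρ.surjective.range_comp (T.1.orderEmbOfFin T.2)
  have h3 : ∀ S : {S : Finset (Fin d) // S.card = k},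
      (k.factorial : ℝ) * (dppWeight Vk S.1 * φ S.1) =
      ∑ τ : Equiv.Perm (Fin k),
        (Vk.submatrix (fun i => S.1.orderEmbOfFin S.2 (τ i)) id).det ^ 2 *
          φ (Finset.univ.image fun i => S.1.orderEmbOfFin S.2 (τ i)) := by
    intro S
    have h4 : ∀ τ : Equiv.Perm (Fin k),
        (Vk.submatrix (fun i => S.1.orderEmbOfFin S.2 (τ i)) id).det ^ 2 *
          φ (Finset.univ.image fun i => S.1.orderEmbOfFin S.2 (τ i)) =
          dppWeight Vk S.1 * φ S.1 := by
      intro τ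
      have h5 : (Vk.submatrix (fun i => S.1.orderEmbOfFin S.2 (τ i)) id).det =
          (Equiv.Perm.sign τ : ℤ) * (Vk.submatrix (S.1.orderEmbOfFin S.2) id).det := by
        rw [← Matrix.det_permute]
        rfl
      have h6 : (Finset.univ.image fun i => S.1.orderEmbOfFin S.2 (τ i)) = S.1 := by
        apply Finset.coe_injective
        rw [Finset.coe_image, Finset.coe_univ, Set.image_univ, hr]
      rw [h5, h6, dppWeight, dif_pos S.2, mul_pow, sq ((Equiv.Perm.sign τ : ℤ) : ℝ),
        sign_mul_sign_self, one_mul]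
    rw [Finset.sum_congr rfl fun τ _ => h4 τ]
    simp [Fintype.card_perm]
  rw [h2, Finset.mul_sum, Finset.sum_congr rfl fun S _ => h3 S, ← Fintype.sum_prod_type'
    (f := fun (S : {S : Finset (Fin d) // S.card = k}) (τ : Equiv.Perm (Fin k)) =>
      (Vk.submatrix (fun i => S.1.orderEmbOfFin S.2 (τ i)) id).det ^ 2 *
          φ (Finset.univ.image fun i => S.1.orderEmbOfFin S.2 (τ i)))]
  -- The pairs `(S, τ)` enumerate the injective sequences; any other sequence gives a determinant
  -- with two equal rows.
  refine Fintype.sum_of_injective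
    (fun p : {S : Finset (Fin d) // S.card = k} × Equiv.Perm (Fin k) =>
      fun i => p.1.1.orderEmbOfFin p.1.2 (p.2 i)) ?_ _ _ ?_ fun _ => rfl
  · rintro ⟨S, τ⟩ ⟨S', τ'⟩ h
    have hS : S = S' := by
      apply Subtype.ext
      apply Finset.coe_injective
      rw [← hr S τ, ← hr S' τ']
      exact congrArg Set.range h
    subst hS
    refine Prod.ext rfl (Equiv.ext fun i => ?_)
    exact (S.1.orderEmbOfFin S.2).injective (congrFun h i)
  · intro f hf
    by_cases hinj : Function.Injective f
    · exfalso
      apply hf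
      have hcard : (Finset.univ.image f).card = k := by
        rw [Finset.card_image_of_injective _ hinj, Finset.card_univ, Fintype.card_fin]
      let g : Fin k → Fin k := fun i => ((Finset.univ.image f).orderIsoOfFin hcard).symm
        ⟨f i, Finset.mem_image_of_mem f (Finset.mem_univ i)⟩
      have hg : ∀ i, (Finset.univ.image f).orderEmbOfFin hcard (g i) = f i := by
        intro i
        rw [← Finset.coe_orderIsoOfFin_apply]
        simp [g]
      have hginj : Function.Injective g := by
        intro i j hij
        apply hinj
        rw [← hg i, ← hg j, hij]
      exact ⟨(⟨_, hcard⟩, Equiv.ofBijective g (Finite.injective_iff_bijective.1 hginj)),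
        funext hg⟩
    · simp only [Function.Injective, not_forall] at hinj
      obtain ⟨i, j, hij, hne⟩ := hinj
      rw [Matrix.det_zero_of_row_eq hne, sq, mul_zero, zero_mul]
      funext l
      simp [hij]

/-- The same, for functions supported on the subsets of `A`. -/
theorem factorial_mul_sum_dppWeight_subset {d k : ℕ} (Vk : Matrix (Fin d) (Fin k) ℝ)
    (A : Finset (Fin d)) (φ : Finset (Fin d) → ℝ) :
    (k.factorial : ℝ) * ∑ S, (if S ⊆ A then dppWeight Vk S * φ S else 0) =
      ∑ f : Fin k → A, ((Vk.submatrix (Subtype.val : A → Fin d) id).submatrix f id).det ^ 2 *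
        φ (Finset.univ.image fun i => (f i : Fin d)) := by
  have h := factorial_mul_sum_dppWeight Vk (fun S => if S ⊆ A then φ S else 0)
  simp only [mul_ite, mul_zero] at h
  rw [h]
  symm
  refine Fintype.sum_of_injective (fun (f : Fin k → A) i => (f i : Fin d)) ?_ _ _ ?_ ?_
  · intro f g hfg
    funext i
    exact Subtype.ext (congrFun hfg i)
  · intro f hf
    rw [if_neg]
    intro hs
    exact hf ⟨fun i => ⟨f i, hs (Finset.mem_image_of_mem f (Finset.mem_univ i))⟩, rfl⟩
  · intro f
    rw [if_pos]
    · rfl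
    · intro x hx
      obtain ⟨i, -, rfl⟩ := Finset.mem_image.1 hx
      exact (f i).2

/-! ### Eigenvalue bounds for Gram matrices between `0` and `1`. -/

section Gram

variable {n : Type*} [Fintype n] [DecidableEq n]

theorem trace_adjugate_eq_sum_prod_eigenvalues {G : Matrix n n ℝ} (hG : G.IsHermitian) :
    G.adjugate.trace = ∑ i, ∏ j ∈ Finset.univ.erase i, hG.eigenvalues j := by
  have h := hG.spectral_theorem
  rw [Unitary.conjStarAlgAut_apply] at h
  have h2 : (star (hG.eigenvectorUnitary : Matrix n n ℝ)) * hG.eigenvectorUnitary = 1 :=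
    Unitary.coe_star_mul_self _
  conv_lhs => rw [h]
  rw [Matrix.adjugate_mul_distrib, Matrix.adjugate_mul_distrib, ← Matrix.mul_assoc,
    Matrix.trace_mul_comm, ← Matrix.mul_assoc, ← Matrix.adjugate_mul_distrib, h2,
    Matrix.adjugate_one, Matrix.one_mul, Matrix.adjugate_diagonal, Matrix.trace_diagonal]
  rfl

/-- The Weierstrass product inequality, used with `x i = 1 - λ i`. -/
theorem one_sub_sum_le_prod_one_sub {ι : Type*} (s : Finset ι) (x : ι → ℝ)
    (h0 : ∀ i, 0 ≤ x i) (h1 : ∀ i, x i ≤ 1) : 1 - ∑ i ∈ s, x i ≤ ∏ i ∈ s, (1 - x i) := by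
  classical
  induction s using Finset.induction_on with
  | empty => simp
  | insert a s ha ih =>
    rw [Finset.sum_insert ha, Finset.prod_insert ha]
    have hs : ∏ i ∈ s, (1 - x i) ≤ 1 :=
      Finset.prod_le_one (fun i _ => by linarith [h1 i]) (fun i _ => by linarith [h0 i])
    nlinarith [h0 a, h1 a]

/-- If `0 ≤ G ≤ 1` and `tr G ≥ k - 1 + 1/θ`, then `det G ≥ 1/θ` and
`tr (adj G) ≤ (k - 1 + θ) det G`. -/
theorem det_and_trace_adjugate_bound {G : Matrix n n ℝ} (hG : G.PosSemidef)
    (hG1 : (1 - G).PosSemidef) {θ : ℝ} (hθ : 1 < θ)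
    (htr : (Fintype.card n : ℝ) - 1 + 1 / θ ≤ G.trace) :
    1 / θ ≤ G.det ∧ G.adjugate.trace ≤ ((Fintype.card n : ℝ) - 1 + θ) * G.det := by
  set lam := hG.isHermitian.eigenvalues with hlam
  have hθ0 : 0 < θ := by linarith
  have hl0 : ∀ i, 0 ≤ lam i := hG.eigenvalues_nonneg
  have hl1 : ∀ i, lam i ≤ 1 := by
    intro i
    have h := hG1.dotProduct_mulVec_nonneg (hG.isHermitian.eigenvectorBasis i)
    rw [Matrix.sub_mulVec, Matrix.one_mulVec, hG.isHermitian.mulVec_eigenvectorBasis,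
      dotProduct_sub, dotProduct_smul] at h
    have h2 : star ⇑(hG.isHermitian.eigenvectorBasis i) ⬝ᵥ
        ⇑(hG.isHermitian.eigenvectorBasis i) = 1 := by
      have h3 := hG.isHermitian.eigenvectorBasis.orthonormal.1 i
      have h4 := EuclideanSpace.inner_eq_star_dotProduct (𝕜 := ℝ)
        (hG.isHermitian.eigenvectorBasis i) (hG.isHermitian.eigenvectorBasis i)
      rw [real_inner_self_eq_norm_sq, h3, dotProduct_comm] at h4
      linarith
    rw [h2] at h
    simp only [smul_eq_mul, mul_one] at h
    linarith
  have hsum : G.trace = ∑ i, lam i := hG.isHermitian.trace_eq_sum_eigenvalues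
  have hdet : G.det = ∏ i, lam i := hG.isHermitian.det_eq_prod_eigenvalues
  have hx : ∑ i, (1 - lam i) ≤ 1 - 1 / θ := by
    rw [Finset.sum_sub_distrib]
    simp only [Finset.sum_const, Finset.card_univ, nsmul_eq_mul, mul_one]
    linarith
  have hd : 1 / θ ≤ G.det := by
    have := one_sub_sum_le_prod_one_sub Finset.univ (fun i => 1 - lam i)
      (fun i => by linarith [hl1 i]) (fun i => by linarith [hl0 i])
    simp only [sub_sub_cancel] at this
    rw [hdet]
    linarith
  refine ⟨hd, ?_⟩
  have hD0 : 0 < G.det := lt_of_lt_of_le (by positivity) hd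
  rw [trace_adjugate_eq_sum_prod_eigenvalues hG.isHermitian, ← hlam]
  -- After division by `det G` this is `1/λ = 1 + (1 - λ)/λ ≤ 1 + θ (1 - λ)`. It needs `λ ≥ 1/θ`,
  -- which holds because one deficit `1 - λ` is at most the sum of all of them.
  have hm : ∀ i, ∏ j ∈ Finset.univ.erase i, lam j ≤ G.det + (1 - lam i) * (θ * G.det) := by
    intro i
    have h1 : lam i * ∏ j ∈ Finset.univ.erase i, lam j = G.det := by
      rw [hdet, Finset.mul_prod_erase _ _ (Finset.mem_univ i)]
    have h2 : 1 / θ ≤ lam i := by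
      have := Finset.single_le_sum (f := fun i => 1 - lam i)
        (fun i _ => by linarith [hl1 i]) (Finset.mem_univ i)
      linarith
    have h3 : 0 ≤ ∏ j ∈ Finset.univ.erase i, lam j := Finset.prod_nonneg fun j _ => hl0 j
    have h4 : 1 ≤ θ * lam i := by
      rw [div_le_iff₀ hθ0] at h2
      linarith
    have h5 : ∏ j ∈ Finset.univ.erase i, lam j ≤ θ * G.det := by
      rw [← h1]
      nlinarith
    nlinarith [hl1 i, hl0 i]
  calc ∑ i, ∏ j ∈ Finset.univ.erase i, lam j
      ≤ ∑ i, (G.det + (1 - lam i) * (θ * G.det)) := Finset.sum_le_sum fun i _ => hm i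
    _ = Fintype.card n * G.det + (∑ i, (1 - lam i)) * (θ * G.det) := by
        rw [Finset.sum_add_distrib, ← Finset.sum_mul]
        simp
    _ ≤ Fintype.card n * G.det + (1 - 1 / θ) * (θ * G.det) := by
        gcongr
    _ = ((Fintype.card n : ℝ) - 1 + θ) * G.det := by
        field_simp
        ring

/-- The Gram matrix of some of the rows of a matrix with orthonormal columns is at most `1`. -/
theorem posSemidef_one_sub_gram {ι : Type*} [Fintype ι] (V : Matrix ι n ℝ) (hV : Vᵀ * V = 1)
    (A : Finset ι) :
    (1 - (V.submatrix (Subtype.val : A → ι) id)ᵀ * V.submatrix (Subtype.val : A → ι) id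
      ).PosSemidef := by
  classical
  have h : 1 - (V.submatrix (Subtype.val : A → ι) id)ᵀ * V.submatrix (Subtype.val : A → ι) id =
      (V.submatrix (Subtype.val : {x // x ∉ A} → ι) id)ᴴ *
        V.submatrix (Subtype.val : {x // x ∉ A} → ι) id := by
    rw [← hV]
    ext i j
    simp only [Matrix.sub_apply, Matrix.mul_apply, Matrix.transpose_apply, Matrix.submatrix_apply,
      id, Matrix.conjTranspose_apply, star_trivial]
    rw [sub_eq_iff_eq_add', Finset.sum_coe_sort A (fun x => V x i * V x j),
      ← Finset.sum_add_sum_compl A]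
    congr 1
    exact Finset.sum_subtype _ (by simp) _
  rw [h]
  exact Matrix.posSemidef_conjTranspose_mul_self _

end Gram

/-! ### Spectral and Frobenius norms. -/

section Norms

theorem trace_transpose_mul_self {m n : Type*} [Fintype m] [Fintype n] (A : Matrix m n ℝ) :
    (Aᵀ * A).trace = ∑ j, ∑ i, A i j ^ 2 := by
  simp [Matrix.trace, Matrix.mul_apply, sq]

theorem frobeniusNorm_sq {N d : ℕ} (A : Matrix (Fin N) (Fin d) ℝ) :
    frobeniusNorm A ^ 2 = (Aᵀ * A).trace := by
  rw [trace_transpose_mul_self, Finset.sum_comm, frobeniusNorm, Matrix.frobenius_norm_def,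
    ← Real.sqrt_eq_rpow]
  rw [Real.sq_sqrt (by positivity)]
  simp

theorem spectralNorm_nonneg {N d : ℕ} (A : Matrix (Fin N) (Fin d) ℝ) : 0 ≤ spectralNorm A := by
  unfold spectralNorm
  open scoped Matrix.Norms.L2Operator in
  exact norm_nonneg _

theorem sum_mulVec_sq_le {N d : ℕ} (A : Matrix (Fin N) (Fin d) ℝ) (x : Fin d → ℝ) :
    ∑ i, (A *ᵥ x) i ^ 2 ≤ spectralNorm A ^ 2 * ∑ j, x j ^ 2 := by
  open scoped Matrix.Norms.L2Operator in
  have h := Matrix.l2_opNorm_mulVec A (WithLp.toLp 2 x)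
  have h2 := pow_le_pow_left₀ (norm_nonneg _) h 2
  rw [mul_pow, EuclideanSpace.norm_sq_eq, EuclideanSpace.norm_sq_eq] at h2
  simpa [spectralNorm] using h2

theorem spectralNorm_mul_le {N m d : ℕ} (A : Matrix (Fin N) (Fin m) ℝ)
    (B : Matrix (Fin m) (Fin d) ℝ) : spectralNorm (A * B) ≤ spectralNorm A * spectralNorm B :=
  Matrix.l2_opNorm_mul A B

theorem spectralNorm_add_le {N d : ℕ} (A B : Matrix (Fin N) (Fin d) ℝ) :
    spectralNorm (A + B) ≤ spectralNorm A + spectralNorm B := by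
  open scoped Matrix.Norms.L2Operator in
  exact norm_add_le A B

theorem spectralNorm_transpose {N d : ℕ} (A : Matrix (Fin N) (Fin d) ℝ) :
    spectralNorm Aᵀ = spectralNorm A := by
  rw [← Matrix.conjTranspose_eq_transpose_of_trivial]
  exact Matrix.l2_opNorm_conjTranspose A

theorem spectralNorm_transpose_mul_self {N d : ℕ} (A : Matrix (Fin N) (Fin d) ℝ) :
    spectralNorm (Aᵀ * A) = spectralNorm A ^ 2 := by
  rw [← Matrix.conjTranspose_eq_transpose_of_trivial, sq]
  exact Matrix.l2_opNorm_conjTranspose_mul_self A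

theorem spectralNorm_mul_transpose_self {N d : ℕ} (A : Matrix (Fin N) (Fin d) ℝ) :
    spectralNorm (A * Aᵀ) = spectralNorm A ^ 2 := by
  rw [← spectralNorm_transpose A, ← spectralNorm_transpose_mul_self, Matrix.transpose_transpose]

theorem spectralNorm_diagonal_le {d : ℕ} (v : Fin d → ℝ) {c : ℝ} (hc : 0 ≤ c)
    (h : ∀ i, |v i| ≤ c) : spectralNorm (Matrix.diagonal v) ≤ c := by
  have h2 : spectralNorm (Matrix.diagonal v) = ‖v‖ := Matrix.l2_opNorm_diagonal v
  rw [h2]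
  exact (pi_norm_le_iff_of_nonneg hc).2 h

theorem spectralNorm_one_le (d : ℕ) : spectralNorm (1 : Matrix (Fin d) (Fin d) ℝ) ≤ 1 := by
  rw [← Matrix.diagonal_one]
  exact spectralNorm_diagonal_le _ zero_le_one (by simp)

theorem spectralNorm_le_one_of_orthonormal {N d : ℕ} {A : Matrix (Fin N) (Fin d) ℝ}
    (h : Aᵀ * A = 1) : spectralNorm A ≤ 1 := by
  have h2 := spectralNorm_transpose_mul_self A
  rw [h] at h2
  have := spectralNorm_one_le d
  have := spectralNorm_nonneg A
  nlinarith

/-- Cauchy-Schwarz in each row. -/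
theorem spectralNorm_sq_le_trace {N d : ℕ} (A : Matrix (Fin N) (Fin d) ℝ) :
    spectralNorm A ^ 2 ≤ (Aᵀ * A).trace := by
  have h0 : 0 ≤ (Aᵀ * A).trace := by
    rw [trace_transpose_mul_self]
    positivity
  refine (Real.le_sqrt (spectralNorm_nonneg A) h0).1 ?_
  unfold spectralNorm
  rw [Matrix.l2_opNorm_def]
  refine ContinuousLinearMap.opNorm_le_bound _ (Real.sqrt_nonneg _) fun x => ?_
  refine (sq_le_sq₀ (norm_nonneg _) (by positivity)).1 ?_
  rw [mul_pow, Real.sq_sqrt h0, EuclideanSpace.norm_sq_eq, EuclideanSpace.norm_sq_eq,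
    trace_transpose_mul_self, Finset.sum_comm, Finset.sum_mul]
  refine Finset.sum_le_sum fun i _ => ?_
  have := Finset.sum_mul_sq_le_sq_mul_sq Finset.univ (fun j => A i j) (fun j => x j)
  simpa [Matrix.mulVec, dotProduct] using this

theorem trace_transpose_mul_mul_le {N m d : ℕ} (E : Matrix (Fin N) (Fin m) ℝ)
    (C : Matrix (Fin m) (Fin d) ℝ) :
    ((E * C)ᵀ * (E * C)).trace ≤ spectralNorm E ^ 2 * (Cᵀ * C).trace := by
  rw [trace_transpose_mul_self, trace_transpose_mul_self, Finset.mul_sum]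
  exact Finset.sum_le_sum fun j _ => sum_mulVec_sq_le E (fun i => C i j)

end Norms

/-! ### The error of the oblique projection. -/

section Residual

variable {N d k : ℕ} {E : Matrix (Fin N) (Fin d) ℝ} {V C : Matrix (Fin d) (Fin k) ℝ}

/-- As `E V = 0`, the matrix `C` may be replaced by `C - V`, whose squared Frobenius norm is smaller
by exactly `k`. This saving later absorbs the leading `1`. -/
theorem spectralNorm_residual_sq_le (hV : Vᵀ * V = 1) (hC : Vᵀ * C = 1) (hE : E * V = 0) :
    spectralNorm (E - E * C * Vᵀ) ^ 2 ≤ spectralNorm E ^ 2 * (1 + ((Cᵀ * C).trace - k)) := by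
  have hE' : Vᵀ * Eᵀ = 0 := by rw [← Matrix.transpose_mul, hE, Matrix.transpose_zero]
  have hC' : Cᵀ * V = 1 := by
    rw [← Matrix.transpose_transpose V, ← Matrix.transpose_mul, hC, Matrix.transpose_one]
  have ht : ((C - V)ᵀ * (C - V)).trace = (Cᵀ * C).trace - k := by
    rw [Matrix.transpose_sub, Matrix.sub_mul, Matrix.mul_sub, Matrix.mul_sub, hV, hC, hC']
    simp
  have hM : (E - E * C * Vᵀ) * (E - E * C * Vᵀ)ᵀ = E * (1 + (C - V) * (C - V)ᵀ) * Eᵀ := by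
    have h1 : E * (C - V) = E * C := by rw [Matrix.mul_sub, hE, sub_zero]
    have h2 : (C - V)ᵀ * Eᵀ = Cᵀ * Eᵀ := by
      rw [← Matrix.transpose_mul, h1, Matrix.transpose_mul]
    have h3 : E * (1 + (C - V) * (C - V)ᵀ) * Eᵀ = E * Eᵀ + E * (C - V) * ((C - V)ᵀ * Eᵀ) := by
      simp only [Matrix.mul_add, Matrix.add_mul, Matrix.mul_one, Matrix.mul_assoc]
    rw [h3, h1, h2, Matrix.transpose_sub, Matrix.transpose_mul, Matrix.transpose_mul,
      Matrix.transpose_transpose, Matrix.sub_mul, Matrix.mul_sub, Matrix.mul_sub,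
      ← Matrix.mul_assoc E V, hE, Matrix.zero_mul, sub_zero, Matrix.mul_assoc (E * C) Vᵀ Eᵀ, hE',
      Matrix.mul_zero, zero_sub, sub_neg_eq_add, Matrix.mul_assoc (E * C) Vᵀ,
      ← Matrix.mul_assoc Vᵀ V, hV, Matrix.one_mul]
  have h4 : spectralNorm (1 + (C - V) * (C - V)ᵀ) ≤ 1 + ((Cᵀ * C).trace - k) := by
    refine (spectralNorm_add_le _ _).trans (add_le_add (spectralNorm_one_le d) ?_)
    rw [spectralNorm_mul_transpose_self, ← ht]
    exact spectralNorm_sq_le_trace _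
  rw [← spectralNorm_mul_transpose_self, hM]
  calc spectralNorm (E * (1 + (C - V) * (C - V)ᵀ) * Eᵀ)
      ≤ spectralNorm E * spectralNorm (1 + (C - V) * (C - V)ᵀ) * spectralNorm Eᵀ :=
        (spectralNorm_mul_le _ _).trans
          (mul_le_mul_of_nonneg_right (spectralNorm_mul_le _ _) (spectralNorm_nonneg _))
    _ = spectralNorm E ^ 2 * spectralNorm (1 + (C - V) * (C - V)ᵀ) := by
        rw [spectralNorm_transpose]; ring
    _ ≤ _ := mul_le_mul_of_nonneg_left h4 (sq_nonneg _)

/-- The cross terms vanish because the rows of `E` are orthogonal to the columns of `V`. -/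
theorem frobeniusNorm_residual_sq_le (hV : Vᵀ * V = 1) (hE : E * V = 0) :
    frobeniusNorm (E - E * C * Vᵀ) ^ 2 ≤
      frobeniusNorm E ^ 2 + spectralNorm E ^ 2 * (Cᵀ * C).trace := by
  have hE' : Vᵀ * Eᵀ = 0 := by rw [← Matrix.transpose_mul, hE, Matrix.transpose_zero]
  have h : ((E - E * C * Vᵀ)ᵀ * (E - E * C * Vᵀ)).trace =
      (Eᵀ * E).trace + ((E * C)ᵀ * (E * C)).trace := by
    rw [Matrix.trace_mul_comm, Matrix.trace_mul_comm Eᵀ, Matrix.trace_mul_comm (E * C)ᵀ,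
      ← Matrix.trace_add, Matrix.transpose_sub, Matrix.transpose_mul (E * C),
      Matrix.transpose_transpose, Matrix.sub_mul, Matrix.mul_sub, Matrix.mul_sub,
      ← Matrix.mul_assoc E V, hE, Matrix.zero_mul, sub_zero, Matrix.mul_assoc (E * C) Vᵀ Eᵀ, hE',
      Matrix.mul_zero, zero_sub, sub_neg_eq_add, Matrix.mul_assoc (E * C) Vᵀ,
      ← Matrix.mul_assoc Vᵀ V, hV, Matrix.one_mul]
  rw [frobeniusNorm_sq, frobeniusNorm_sq, h]
  exact add_le_add le_rfl (trace_transpose_mul_mul_le E C)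

end Residual

/-! ### The loss of a fixed selection of columns. -/

section Selection

variable {N d k : ℕ}

/-- The matrix whose `i`-th column is the `f i`-th vector of the standard basis. -/
noncomputable def selection (f : Fin k → Fin d) : Matrix (Fin d) (Fin k) ℝ :=
  Matrix.of fun a i => if a = f i then 1 else 0

theorem transpose_mul_selection (f : Fin k → Fin d) (V : Matrix (Fin d) (Fin k) ℝ) :
    Vᵀ * selection f = (V.submatrix f id)ᵀ := by
  ext i j
  simp [selection, Matrix.mul_apply]

theorem selection_transpose_mul_self {f : Fin k → Fin d} (hf : Function.Injective f) :
    (selection f)ᵀ * selection f = 1 := by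
  ext i j
  simp [selection, Matrix.mul_apply, Matrix.one_apply, hf.eq_iff, eq_comm]

theorem mul_selection_mul_mem_colSpan (X : Matrix (Fin N) (Fin d) ℝ) (f : Fin k → Fin d)
    (B : Matrix (Fin k) (Fin d) ℝ) :
    X * selection f * B ∈ colSpan X (Finset.univ.image f) := by
  refine ⟨(selection f * B).submatrix Subtype.val id, ?_⟩
  rw [Matrix.mul_assoc]
  ext i j
  rw [Matrix.mul_apply (M := X)]
  change ∑ a : Finset.univ.image f, X i a * (selection f * B) a j = _
  rw [Finset.sum_coe_sort (Finset.univ.image f) (fun a => X i a * (selection f * B) a j)]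
  refine Finset.sum_subset (Finset.subset_univ _) fun a _ ha => ?_
  rw [Matrix.mul_apply, Finset.sum_eq_zero, mul_zero]
  intro l _
  have : a ≠ f l := fun h => ha (h ▸ Finset.mem_image_of_mem f (Finset.mem_univ l))
  simp [selection, this]

/-- The coefficients `Z W⁻ᵀ` of the oblique projection onto the selected coordinates along the
orthogonal complement of the columns of `V`. -/
noncomputable def obliqueCoeff (V : Matrix (Fin d) (Fin k) ℝ) (f : Fin k → Fin d) :
    Matrix (Fin d) (Fin k) ℝ :=
  selection f * ((V.submatrix f id)⁻¹)ᵀ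

theorem injective_of_det_submatrix_ne_zero {V : Matrix (Fin d) (Fin k) ℝ} {f : Fin k → Fin d}
    (h : (V.submatrix f id).det ≠ 0) : Function.Injective f := by
  intro i j hij
  by_contra hne
  refine h (Matrix.det_zero_of_row_eq hne ?_)
  funext l
  simp [hij]

theorem transpose_mul_obliqueCoeff {V : Matrix (Fin d) (Fin k) ℝ} {f : Fin k → Fin d}
    (h : (V.submatrix f id).det ≠ 0) : Vᵀ * obliqueCoeff V f = 1 := by
  rw [obliqueCoeff, ← Matrix.mul_assoc, transpose_mul_selection, ← Matrix.transpose_mul,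
    Matrix.nonsing_inv_mul _ (isUnit_iff_ne_zero.2 h), Matrix.transpose_one]

/-- Writing `W⁻¹ = adj W / det W` clears the denominator, so the weighted loss is controlled by a
polynomial in the entries of `V`, which can be summed over all selections. -/
theorem det_sq_mul_trace_obliqueCoeff {V : Matrix (Fin d) (Fin k) ℝ} {f : Fin k → Fin d}
    (h : (V.submatrix f id).det ≠ 0) :
    (V.submatrix f id).det ^ 2 * ((obliqueCoeff V f)ᵀ * obliqueCoeff V f).trace =
      ∑ j, ∑ l, (V.submatrix f id).adjugate l j ^ 2 := by
  have h1 : (obliqueCoeff V f)ᵀ * obliqueCoeff V f =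
      (V.submatrix f id)⁻¹ * ((V.submatrix f id)⁻¹)ᵀ := by
    rw [obliqueCoeff, Matrix.transpose_mul, Matrix.transpose_transpose, Matrix.mul_assoc,
      ← Matrix.mul_assoc _ (selection f),
      selection_transpose_mul_self (injective_of_det_submatrix_ne_zero h), Matrix.one_mul]
  rw [h1, Matrix.trace_mul_comm, trace_transpose_mul_self, Finset.mul_sum]
  refine Finset.sum_congr rfl fun j _ => ?_
  rw [Finset.mul_sum]
  refine Finset.sum_congr rfl fun l _ => ?_
  rw [Matrix.inv_def, Matrix.smul_apply, Ring.inverse_eq_inv', smul_eq_mul]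
  field_simp

theorem matNorm_sub_colProj_le (ν : NormKind) (X : Matrix (Fin N) (Fin d) ℝ)
    (S : Finset (Fin d)) {A : Matrix (Fin N) (Fin d) ℝ} (hA : A ∈ colSpan X S) :
    matNorm ν (X - colProj ν X S) ≤ matNorm ν (X - A) :=
  (exists_colProj ν X S).choose_spec.2 A hA

theorem matNorm_nonneg (ν : NormKind) (A : Matrix (Fin N) (Fin d) ℝ) : 0 ≤ matNorm ν A := by
  cases ν with
  | spectral => exact spectralNorm_nonneg A
  | frobenius =>
    open scoped Matrix.Norms.Frobenius in
    exact norm_nonneg A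

variable {X E : Matrix (Fin N) (Fin d) ℝ} {V : Matrix (Fin d) (Fin k) ℝ} {f : Fin k → Fin d}

/-- The competitor `X C Vᵀ` reproduces the part `X V Vᵀ` exactly, because `Vᵀ C = 1`. -/
theorem matNorm_sub_colProj_sq_le (ν : NormKind) (hX : X = X * V * Vᵀ + E)
    (h : (V.submatrix f id).det ≠ 0) :
    matNorm ν (X - colProj ν X (Finset.univ.image f)) ^ 2 ≤
      matNorm ν (E - E * obliqueCoeff V f * Vᵀ) ^ 2 := by
  refine pow_le_pow_left₀ (matNorm_nonneg _ _) ?_ 2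
  have h1 : X - X * obliqueCoeff V f * Vᵀ = E - E * obliqueCoeff V f * Vᵀ := by
    conv_lhs => rw [hX]
    rw [Matrix.add_mul, Matrix.add_mul, Matrix.mul_assoc (X * V), transpose_mul_obliqueCoeff h,
      Matrix.mul_one]
    abel
  rw [← h1]
  refine matNorm_sub_colProj_le ν X _ ?_
  rw [obliqueCoeff, ← Matrix.mul_assoc, Matrix.mul_assoc (X * selection f)]
  exact mul_selection_mul_mem_colSpan X f _

theorem det_sq_mul_spectral_loss_le (hk : 1 ≤ k) (hV : Vᵀ * V = 1) (hE : E * V = 0)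
    (hX : X = X * V * Vᵀ + E) :
    (V.submatrix f id).det ^ 2 *
        matNorm .spectral (X - colProj .spectral X (Finset.univ.image f)) ^ 2 ≤
      if Function.Injective f then
        spectralNorm E ^ 2 * ∑ j, ∑ l, (V.submatrix f id).adjugate l j ^ 2 else 0 := by
  by_cases h : (V.submatrix f id).det = 0
  · rw [h]
    split_ifs
    · rw [sq, mul_zero, zero_mul]
      positivity
    · simp
  · rw [if_pos (injective_of_det_submatrix_ne_zero h), ← det_sq_mul_trace_obliqueCoeff h,
      mul_left_comm]
    refine mul_le_mul_of_nonneg_left ?_ (sq_nonneg _)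
    refine (matNorm_sub_colProj_sq_le .spectral hX h).trans ?_
    refine (spectralNorm_residual_sq_le hV (transpose_mul_obliqueCoeff h) hE).trans ?_
    refine mul_le_mul_of_nonneg_left ?_ (sq_nonneg _)
    -- With `t` the trace, `1 + (t - k) ≤ t`.
    have : (1 : ℝ) ≤ k := by exact_mod_cast hk
    linarith

theorem det_sq_mul_frobenius_loss_le (hV : Vᵀ * V = 1) (hE : E * V = 0)
    (hX : X = X * V * Vᵀ + E) :
    (V.submatrix f id).det ^ 2 *
        matNorm .frobenius (X - colProj .frobenius X (Finset.univ.image f)) ^ 2 ≤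
      frobeniusNorm E ^ 2 * (V.submatrix f id).det ^ 2 + if Function.Injective f then
        spectralNorm E ^ 2 * ∑ j, ∑ l, (V.submatrix f id).adjugate l j ^ 2 else 0 := by
  by_cases h : (V.submatrix f id).det = 0
  · rw [h]
    split_ifs
    · rw [sq, mul_zero, zero_mul, mul_zero, zero_add]
      positivity
    · simp
  · rw [if_pos (injective_of_det_submatrix_ne_zero h), ← det_sq_mul_trace_obliqueCoeff h,
      mul_left_comm, mul_comm (frobeniusNorm E ^ 2), ← mul_add]
    refine mul_le_mul_of_nonneg_left ?_ (sq_nonneg _)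
    exact (matNorm_sub_colProj_sq_le .frobenius hX h).trans
      (frobeniusNorm_residual_sq_le hV hE)

end Selection

/-! ### Orthonormal columns and orthogonal projections. -/

section Orthonormal

variable {l m n : Type*} [Fintype l] [Fintype m] [Fintype n] [DecidableEq m]

theorem sum_mulVec_sq_of_orthonormal {Q : Matrix n m ℝ} (hQ : Qᵀ * Q = 1) (x : m → ℝ) :
    ∑ i, (Q *ᵥ x) i ^ 2 = ∑ j, x j ^ 2 := by
  have h : (Q *ᵥ x) ⬝ᵥ (Q *ᵥ x) = x ⬝ᵥ x := by
    rw [Matrix.dotProduct_mulVec, Matrix.vecMul_mulVec, hQ, Matrix.vecMul_one]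
  simpa [dotProduct, ← sq] using h

/-- The Pythagorean identity for the orthogonal projection onto the columns of `Q`. -/
theorem transpose_mul_self_eq_add {l : Type*} {Q : Matrix n m ℝ} (hQ : Qᵀ * Q = 1) (Y : Matrix n l ℝ) :
    Yᵀ * Y = (Y - Q * (Qᵀ * Y))ᵀ * (Y - Q * (Qᵀ * Y)) + (Qᵀ * Y)ᵀ * (Qᵀ * Y) := by
  have h : Qᵀ * (Y - Q * (Qᵀ * Y)) = 0 := by
    rw [Matrix.mul_sub, ← Matrix.mul_assoc Qᵀ Q, hQ, Matrix.one_mul, sub_self]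
  have h1 : (Y - Q * (Qᵀ * Y))ᵀ * (Y - Q * (Qᵀ * Y)) = Yᵀ * (Y - Q * (Qᵀ * Y)) := by
    rw [Matrix.transpose_sub, Matrix.sub_mul, Matrix.transpose_mul Q, Matrix.mul_assoc _ Qᵀ, h,
      Matrix.mul_zero, sub_zero]
  rw [h1, Matrix.mul_sub, Matrix.transpose_mul Qᵀ, Matrix.transpose_transpose, Matrix.mul_assoc]
  abel

theorem trace_transpose_mul_self_nonneg (Y : Matrix n l ℝ) : 0 ≤ (Yᵀ * Y).trace := by
  rw [trace_transpose_mul_self]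
  positivity

theorem transpose_mul_self_apply_self {l : Type*} (Y : Matrix n l ℝ) (j : l) :
    (Yᵀ * Y) j j = ∑ i, Y i j ^ 2 := by
  simp [Matrix.mul_apply, sq]

theorem trace_projection_le {Q : Matrix n m ℝ} (hQ : Qᵀ * Q = 1) (Y : Matrix n l ℝ) :
    ((Qᵀ * Y)ᵀ * (Qᵀ * Y)).trace ≤ (Yᵀ * Y).trace := by
  rw [transpose_mul_self_eq_add hQ Y, Matrix.trace_add]
  linarith [trace_transpose_mul_self_nonneg (Y - Q * (Qᵀ * Y))]

theorem projection_diag_le {l : Type*} {Q : Matrix n m ℝ} (hQ : Qᵀ * Q = 1) (Y : Matrix n l ℝ) (j : l) :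
    ((Qᵀ * Y)ᵀ * (Qᵀ * Y)) j j ≤ (Yᵀ * Y) j j := by
  rw [transpose_mul_self_eq_add hQ Y, Matrix.add_apply,
    transpose_mul_self_apply_self (Y - Q * (Qᵀ * Y))]
  have : 0 ≤ ∑ i, (Y - Q * (Qᵀ * Y)) i j ^ 2 := by positivity
  linarith

theorem trace_mul_diagonal_mul_transpose {V : Matrix l m ℝ} (hV : Vᵀ * V = 1)
    (B : Matrix n m ℝ) (v : m → ℝ) :
    ((B * Matrix.diagonal v * Vᵀ)ᵀ * (B * Matrix.diagonal v * Vᵀ)).trace =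
      ∑ j, v j ^ 2 * (Bᵀ * B) j j := by
  rw [Matrix.transpose_mul, Matrix.transpose_transpose, Matrix.trace_mul_comm, Matrix.mul_assoc,
    ← Matrix.mul_assoc Vᵀ V, hV, Matrix.one_mul, Matrix.trace_mul_comm, trace_transpose_mul_self]
  refine Finset.sum_congr rfl fun j _ => ?_
  rw [transpose_mul_self_apply_self, Finset.mul_sum]
  refine Finset.sum_congr rfl fun i _ => ?_
  rw [Matrix.mul_diagonal]
  ring

end Orthonormal

/-- A matrix of rank `m` has its columns in the span of `m` orthonormal vectors. -/
theorem exists_orthonormal_columns {N d : ℕ} (A : Matrix (Fin N) (Fin d) ℝ) :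
    ∃ Q : Matrix (Fin N) (Fin A.rank) ℝ, Qᵀ * Q = 1 ∧ Q * (Qᵀ * A) = A := by
  let K := LinearMap.range (Matrix.toEuclideanLin A)
  have hK : Module.finrank ℝ K = A.rank :=
    (Matrix.rank_eq_finrank_range_toLin A (EuclideanSpace.basisFun (Fin N) ℝ).toBasis
      (EuclideanSpace.basisFun (Fin d) ℝ).toBasis).symm
  let b := (stdOrthonormalBasis ℝ K).reindex (finCongr hK)
  refine ⟨Matrix.of fun i a => (b a : EuclideanSpace ℝ (Fin N)) i, ?_, ?_⟩
  · ext a c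
    have h := orthonormal_iff_ite.1 b.orthonormal c a
    rw [Submodule.coe_inner, EuclideanSpace.inner_eq_star_dotProduct] at h
    rw [Matrix.one_apply, if_congr (eq_comm : a = c ↔ c = a) rfl rfl]
    exact h
  · ext i j
    let y : K := ⟨Matrix.toEuclideanLin A (EuclideanSpace.single j 1), ⟨_, rfl⟩⟩
    have hy : ∀ i, (y : EuclideanSpace ℝ (Fin N)) i = A i j := by
      intro i
      simp [y, Matrix.toLpLin_apply]
    have h := congrArg (fun z : K => (z : EuclideanSpace ℝ (Fin N)) i) (b.sum_repr' y)
    simp only [Submodule.coe_sum, Submodule.coe_smul, Submodule.coe_inner,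
      EuclideanSpace.inner_eq_star_dotProduct] at h
    rw [hy] at h
    rw [← h]
    simp only [WithLp.ofLp_sum, WithLp.ofLp_smul, Finset.sum_apply, Pi.smul_apply, smul_eq_mul,
      Matrix.mul_apply, Matrix.transpose_apply, Matrix.of_apply, dotProduct, hy, Pi.star_apply,
      star_trivial]
    refine Finset.sum_congr rfl fun a _ => ?_
    rw [mul_comm]
    congr 1
    refine Finset.sum_congr rfl fun l _ => ?_
    ring

/-! ### The residual in terms of singular values, and the Eckart-Young lower bounds. -/

section ThinSVD

variable {N d r k : ℕ} {X A : Matrix (Fin N) (Fin d) ℝ} {U : Matrix (Fin N) (Fin r) ℝ}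
  {σ : Fin r → ℝ} {V : Matrix (Fin d) (Fin r) ℝ}

/-- The singular value `σ_{k+1}`, with the convention that it vanishes for `k ≥ r`. -/
noncomputable def nextSingular (k : ℕ) (σ : Fin r → ℝ) : ℝ :=
  if h : k < r then σ ⟨k, h⟩ else 0

/-- The singular values with the first `k` ones replaced by zero. -/
noncomputable def tailSingular (k : ℕ) (σ : Fin r → ℝ) (j : Fin r) : ℝ :=
  if k ≤ j.val then σ j else 0

/-- The residual `X - X V_k V_kᵀ` in terms of the singular value decomposition. -/
noncomputable def residual (k : ℕ) (U : Matrix (Fin N) (Fin r) ℝ) (σ : Fin r → ℝ)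
    (V : Matrix (Fin d) (Fin r) ℝ) : Matrix (Fin N) (Fin d) ℝ :=
  U * Matrix.diagonal (tailSingular k σ) * Vᵀ

theorem residual_mul_firstCols (hk : k ≤ r) (hV : Vᵀ * V = 1) :
    residual k U σ V * firstCols hk V = 0 := by
  have h : Vᵀ * firstCols hk V = (1 : Matrix (Fin r) (Fin r) ℝ).submatrix id (Fin.castLE hk) := by
    rw [← hV]
    rfl
  rw [residual, Matrix.mul_assoc, Matrix.mul_assoc, h]
  have h2 : Matrix.diagonal (tailSingular k σ) *
      (1 : Matrix (Fin r) (Fin r) ℝ).submatrix id (Fin.castLE hk) = 0 := by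
    ext i j
    rw [Matrix.diagonal_mul]
    simp only [Matrix.submatrix_apply, id, Matrix.one_apply, Matrix.zero_apply]
    split_ifs with hij
    · have : ¬ k ≤ i.val := by simp [hij]
      simp [tailSingular, this]
    · simp
  rw [h2, Matrix.mul_zero]

theorem IsThinSVD.mul_firstCols_apply (hX : IsThinSVD X U σ V) (hk : k ≤ r) (i : Fin N)
    (j : Fin k) : (X * firstCols hk V) i j = U i (Fin.castLE hk j) * σ (Fin.castLE hk j) := by
  have h : X * V = U * Matrix.diagonal σ := by
    rw [hX.eq, Matrix.mul_assoc, hX.orthV, Matrix.mul_one]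
  have h2 : X * firstCols hk V = (X * V).submatrix id (Fin.castLE hk) := rfl
  rw [h2, h, Matrix.submatrix_apply, Matrix.mul_diagonal, id]

theorem IsThinSVD.eq_add_residual (hX : IsThinSVD X U σ V) (hk : k ≤ r) :
    X = X * firstCols hk V * (firstCols hk V)ᵀ + residual k U σ V := by
  ext i j
  rw [Matrix.add_apply, Matrix.mul_apply]
  simp_rw [hX.mul_firstCols_apply hk]
  conv_lhs => rw [hX.eq]
  rw [residual, Matrix.mul_apply, Matrix.mul_apply (M := U * Matrix.diagonal (tailSingular k σ))]
  simp_rw [Matrix.mul_diagonal, Matrix.transpose_apply, firstCols, Matrix.submatrix_apply, id]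
  have h : ∑ x : Fin k, U i (Fin.castLE hk x) * σ (Fin.castLE hk x) * V j (Fin.castLE hk x) =
      ∑ x : Fin r, if k ≤ x.val then 0 else U i x * σ x * V j x := by
    refine Fintype.sum_of_injective (Fin.castLE hk) (Fin.castLE_injective hk) _ _ ?_ ?_
    · intro x hx
      rw [if_pos]
      by_contra hlt
      exact hx ⟨⟨x, by omega⟩, rfl⟩
    · intro x
      rw [if_neg]
      simp
  rw [h, ← Finset.sum_add_distrib]
  refine Finset.sum_congr rfl fun x _ => ?_
  unfold tailSingular
  split_ifs <;> simp

theorem nextSingular_nonneg (hσ : ∀ i, 0 < σ i) : 0 ≤ nextSingular k σ := by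
  unfold nextSingular
  split_ifs
  · exact (hσ _).le
  · exact le_rfl

theorem IsThinSVD.spectralNorm_residual_le (hX : IsThinSVD X U σ V) :
    spectralNorm (residual k U σ V) ≤ nextSingular k σ := by
  have h0 : 0 ≤ nextSingular k σ := nextSingular_nonneg hX.pos
  have hd : spectralNorm (Matrix.diagonal (tailSingular k σ)) ≤ nextSingular k σ := by
    refine spectralNorm_diagonal_le _ h0 fun i => ?_
    unfold tailSingular
    split_ifs with h
    · have hr : k < r := lt_of_le_of_lt h i.2
      rw [abs_of_pos (hX.pos i), nextSingular, dif_pos hr]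
      exact hX.anti (Fin.mk_le_of_le_val h)
    · simpa using h0
  have hU := spectralNorm_le_one_of_orthonormal hX.orthU
  have hV := spectralNorm_le_one_of_orthonormal hX.orthV
  calc spectralNorm (residual k U σ V)
      ≤ spectralNorm U * spectralNorm (Matrix.diagonal (tailSingular k σ)) * spectralNorm Vᵀ :=
        (spectralNorm_mul_le _ _).trans
          (mul_le_mul_of_nonneg_right (spectralNorm_mul_le _ _) (spectralNorm_nonneg _))
    _ ≤ 1 * nextSingular k σ * 1 := by
        rw [spectralNorm_transpose]
        exact mul_le_mul (mul_le_mul hU hd (spectralNorm_nonneg _) zero_le_one) hV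
          (spectralNorm_nonneg _) (by linarith)
    _ = nextSingular k σ := by ring

theorem IsThinSVD.frobeniusNorm_residual_sq (hX : IsThinSVD X U σ V) :
    frobeniusNorm (residual k U σ V) ^ 2 = ∑ j : Fin r with k ≤ j.val, σ j ^ 2 := by
  rw [frobeniusNorm_sq, residual, trace_mul_diagonal_mul_transpose hX.orthV, hX.orthU,
    Finset.sum_filter]
  refine Finset.sum_congr rfl fun j _ => ?_
  unfold tailSingular
  split_ifs <;> simp

theorem exists_mulVec_eq_zero_of_rank_lt {m n : ℕ} (B : Matrix (Fin m) (Fin n) ℝ)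
    (h : B.rank < n) : ∃ c : Fin n → ℝ, c ≠ 0 ∧ B *ᵥ c = 0 := by
  by_contra hc
  push Not at hc
  have hinj : Function.Injective B.mulVecLin := by
    rw [injective_iff_map_eq_zero]
    intro c hc0
    by_contra hne
    exact hc c hne hc0
  have := LinearMap.finrank_range_of_inj hinj
  rw [Module.finrank_fin_fun] at this
  exact absurd this h.ne

/-- The Eckart-Young lower bound for the spectral norm. -/
theorem IsThinSVD.nextSingular_le (hX : IsThinSVD X U σ V) (hA : A.rank ≤ k) :
    nextSingular k σ ≤ spectralNorm (X - A) := by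
  unfold nextSingular
  split_ifs with h
  swap
  · exact spectralNorm_nonneg _
  -- Since `h : k < r` is read as `k + 1 ≤ r`, here `firstCols h V` has `k + 1` columns; a matrix of
  -- rank at most `k` kills a nonzero vector in their span.
  obtain ⟨c, hc, hc0⟩ := exists_mulVec_eq_zero_of_rank_lt (A * firstCols h V)
    (lt_of_le_of_lt (Matrix.rank_mul_le_left _ _) (Nat.lt_succ_of_le hA))
  have h1 : (X - A) *ᵥ (firstCols h V *ᵥ c) =
      firstCols h U *ᵥ fun j => σ (Fin.castLE h j) * c j := by
    rw [Matrix.mulVec_mulVec, Matrix.sub_mul, Matrix.sub_mulVec, hc0, sub_zero]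
    funext i
    simp only [Matrix.mulVec, dotProduct, hX.mul_firstCols_apply, mul_assoc]
    rfl
  have h2 := sum_mulVec_sq_le (X - A) (firstCols h V *ᵥ c)
  rw [h1, sum_mulVec_sq_of_orthonormal (firstCols_orth h hX.orthU),
    sum_mulVec_sq_of_orthonormal (firstCols_orth h hX.orthV)] at h2
  have h3 : σ ⟨k, h⟩ ^ 2 * ∑ j, c j ^ 2 ≤ ∑ j, (σ (Fin.castLE h j) * c j) ^ 2 := by
    rw [Finset.mul_sum]
    refine Finset.sum_le_sum fun j _ => ?_
    rw [mul_pow]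
    refine mul_le_mul_of_nonneg_right ?_ (sq_nonneg _)
    refine pow_le_pow_left₀ (hX.pos _).le (hX.anti ?_) 2
    exact Nat.lt_succ_iff.1 j.2
  have h4 : 0 < ∑ j, c j ^ 2 := by
    obtain ⟨j, hj⟩ := Function.ne_iff.1 hc
    exact Finset.sum_pos' (fun _ _ => sq_nonneg _) ⟨j, Finset.mem_univ j, by
      have : c j ≠ 0 := hj
      positivity⟩
  exact (sq_le_sq₀ (hX.pos _).le (spectralNorm_nonneg _)).1
    (le_of_mul_le_mul_right (h3.trans h2) h4)

/-- Weights in `[0, 1]` of total at most `k` remove the most when they are placed on the `k` largest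
terms. -/
theorem sum_tail_le_sum_mul_one_sub (hσ : ∀ i, 0 < σ i) (hanti : Antitone σ) {w : Fin r → ℝ}
    (hk : k ≤ r) (hw0 : ∀ j, 0 ≤ w j) (hw1 : ∀ j, w j ≤ 1) (hw : ∑ j, w j ≤ k) :
    ∑ j : Fin r with k ≤ j.val, σ j ^ 2 ≤ ∑ j, σ j ^ 2 * (1 - w j) := by
  have hs := nextSingular_nonneg (k := k) hσ
  have hcard : ∑ j : Fin r, (if k ≤ j.val then (0 : ℝ) else 1) = k := by
    rw [← Fintype.sum_of_injective (Fin.castLE hk) (Fin.castLE_injective hk) (fun _ => (1 : ℝ))]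
    · simp
    · intro x hx
      rw [if_pos]
      by_contra hlt
      exact hx ⟨⟨x, by omega⟩, rfl⟩
    · intro x
      rw [if_neg]
      simp
  -- With threshold `s = σ_{k+1}`, this says that `(σ_j² - s²) (1_{j<k} - w_j) ≥ 0`, with `j`
  -- counted from `0`: both factors change sign at the same place.
  have h : ∀ j, (if k ≤ j.val then σ j ^ 2 else 0) +
      nextSingular k σ ^ 2 * ((if k ≤ j.val then 0 else 1) - w j) ≤ σ j ^ 2 * (1 - w j) := by
    intro j
    split_ifs with hj
    · have hr : k < r := lt_of_le_of_lt hj j.2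
      have h1 : σ j ≤ nextSingular k σ := by
        rw [nextSingular, dif_pos hr]
        exact hanti (Fin.mk_le_of_le_val hj)
      have h2 := mul_le_mul_of_nonneg_right (pow_le_pow_left₀ (hσ j).le h1 2) (hw0 j)
      linarith
    · have h1 : nextSingular k σ ≤ σ j := by
        unfold nextSingular
        split_ifs with hr
        · exact hanti (Fin.le_def.2 (by simp only; omega))
        · exact (hσ j).le
      have h2 := mul_le_mul_of_nonneg_right (pow_le_pow_left₀ hs h1 2) (sub_nonneg.2 (hw1 j))
      linarith
  have h2 := Finset.sum_le_sum fun j (_ : j ∈ Finset.univ) => h j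
  rw [Finset.sum_add_distrib, ← Finset.mul_sum, Finset.sum_sub_distrib, hcard,
    ← Finset.sum_filter] at h2
  have h3 := mul_nonneg (sq_nonneg (nextSingular k σ)) (sub_nonneg.2 hw)
  linarith

/-- The Eckart-Young lower bound for the Frobenius norm. -/
theorem IsThinSVD.sum_tail_le (hX : IsThinSVD X U σ V) (hk : k ≤ r) (hA : A.rank ≤ k) :
    ∑ j : Fin r with k ≤ j.val, σ j ^ 2 ≤ frobeniusNorm (X - A) ^ 2 := by
  obtain ⟨Q, hQ, hQA⟩ := exists_orthonormal_columns A
  rw [frobeniusNorm_sq]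
  -- Projecting `X` onto the column space of `A` does at least as well as `A`. The remaining error
  -- is `∑ σ_j² (1 - w_j)`, where `w_j` is the squared length of the projection of the `j`-th left
  -- singular vector.
  have h1 : (X - A) - Q * (Qᵀ * (X - A)) = X - Q * (Qᵀ * X) := by
    rw [Matrix.mul_sub, Matrix.mul_sub, hQA]
    abel
  have h2 : (((X - Q * (Qᵀ * X))ᵀ * (X - Q * (Qᵀ * X)))).trace ≤ ((X - A)ᵀ * (X - A)).trace := by
    rw [transpose_mul_self_eq_add hQ (X - A), h1, Matrix.trace_add]
    linarith [trace_transpose_mul_self_nonneg (Qᵀ * (X - A))]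
  have h3 := congrArg Matrix.trace (transpose_mul_self_eq_add hQ X)
  rw [Matrix.trace_add] at h3
  have h4 : (Xᵀ * X).trace = ∑ j, σ j ^ 2 := by
    rw [hX.eq, trace_mul_diagonal_mul_transpose hX.orthV, hX.orthU]
    simp
  have h5 : ((Qᵀ * X)ᵀ * (Qᵀ * X)).trace =
      ∑ j, σ j ^ 2 * ((Qᵀ * U)ᵀ * (Qᵀ * U)) j j := by
    rw [← trace_mul_diagonal_mul_transpose hX.orthV, Matrix.mul_assoc Qᵀ U,
      Matrix.mul_assoc Qᵀ, ← hX.eq]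
  -- Exchanging the roles of `Q` and `U` bounds the total weight by the number of columns of `Q`,
  -- which is the rank of `A`.
  have h6 : ((Qᵀ * U)ᵀ * (Qᵀ * U)).trace ≤ k := by
    rw [Matrix.trace_mul_comm]
    have h7 := trace_projection_le hX.orthU Q
    rw [hQ, Matrix.trace_one, Fintype.card_fin] at h7
    have h8 : (Uᵀ * Q) = (Qᵀ * U)ᵀ := by
      rw [Matrix.transpose_mul, Matrix.transpose_transpose]
    rw [h8, Matrix.transpose_transpose] at h7
    exact h7.trans (by exact_mod_cast hA)
  refine (sum_tail_le_sum_mul_one_sub hX.pos hX.anti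
    (w := fun j => ((Qᵀ * U)ᵀ * (Qᵀ * U)) j j) hk ?_ ?_ h6).trans ?_
  · intro j
    simp only [transpose_mul_self_apply_self]
    positivity
  · intro j
    have := projection_diag_le hQ U j
    rwa [hX.orthU, Matrix.one_apply_eq] at this
  · simp only [mul_sub, mul_one, Finset.sum_sub_distrib]
    linarith

end ThinSVD

/-! ### Probabilities and conditional expectations for the projection process. -/

section ProjectionProcess

variable {d k : ℕ} {Vk : Matrix (Fin d) (Fin k) ℝ}

theorem integral_dpp (Vk : Matrix (Fin d) (Fin k) ℝ) (φ : Finset (Fin d) → ℝ) :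
    ∫ S, φ S ∂dpp Vk = ∑ S, dppWeight Vk S * φ S := by
  rw [dpp, integral_finsetSum_measure]
  · refine Finset.sum_congr rfl fun S _ => ?_
    rw [integral_smul_measure, integral_dirac, ENNReal.toReal_ofReal (dppWeight_nonneg Vk S),
      smul_eq_mul]
  · intro S _
    exact (integrable_dirac (by simp)).smul_measure ENNReal.ofReal_ne_top

theorem dpp_real_subset (Vk : Matrix (Fin d) (Fin k) ℝ) (A : Finset (Fin d)) :
    (dpp Vk).real {S | S ⊆ A} = ∑ S, if S ⊆ A then dppWeight Vk S else 0 := by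
  rw [← integral_indicator_one MeasurableSet.of_discrete, integral_dpp]
  refine Finset.sum_congr rfl fun S _ => ?_
  by_cases h : S ⊆ A <;> simp [Set.indicator, h]

theorem integral_cond_dpp_subset (Vk : Matrix (Fin d) (Fin k) ℝ) (A : Finset (Fin d))
    (φ : Finset (Fin d) → ℝ) :
    ∫ S, φ S ∂ProbabilityTheory.cond (dpp Vk) {S | S ⊆ A} =
      ((dpp Vk).real {S | S ⊆ A})⁻¹ * ∑ S, if S ⊆ A then dppWeight Vk S * φ S else 0 := by
  rw [ProbabilityTheory.cond, integral_smul_measure, ENNReal.toReal_inv, smul_eq_mul,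
    ← integral_indicator MeasurableSet.of_discrete, integral_dpp]
  congr 1
  refine Finset.sum_congr rfl fun S _ => ?_
  by_cases h : S ⊆ A <;> simp [Set.indicator, h]

/-- The Gram matrix of the rows indexed by `A`. -/
noncomputable def rowGram (Vk : Matrix (Fin d) (Fin k) ℝ) (A : Finset (Fin d)) :
    Matrix (Fin k) (Fin k) ℝ :=
  (Vk.submatrix (Subtype.val : A → Fin d) id)ᵀ * Vk.submatrix (Subtype.val : A → Fin d) id

theorem dpp_real_subset_eq_det (Vk : Matrix (Fin d) (Fin k) ℝ) (A : Finset (Fin d)) :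
    (dpp Vk).real {S | S ⊆ A} = (rowGram Vk A).det := by
  have h := factorial_mul_sum_dppWeight_subset Vk A (fun _ => 1)
  simp only [mul_one] at h
  rw [sum_det_submatrix_sq, Fintype.card_fin] at h
  rw [dpp_real_subset]
  exact mul_left_cancel₀ (by exact_mod_cast k.factorial_ne_zero) h

/-- A bound for a sum against the weights from a bound for every sequence of indices. -/
theorem sum_dppWeight_subset_le {A : Finset (Fin d)} (hA : A.Nonempty)
    {φ : Finset (Fin d) → ℝ} {a b : ℝ}
    (h : ∀ f : Fin k → Fin d, (Vk.submatrix f id).det ^ 2 * φ (Finset.univ.image f) ≤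
      a * (Vk.submatrix f id).det ^ 2 + if Function.Injective f then
        b * ∑ j, ∑ l, (Vk.submatrix f id).adjugate l j ^ 2 else 0) :
    ∑ S, (if S ⊆ A then dppWeight Vk S * φ S else 0) ≤
      a * (rowGram Vk A).det +
        b * (((A.card : ℝ) - k + 1) * (rowGram Vk A).adjugate.trace) := by
  have hk : (0 : ℝ) < k.factorial := by exact_mod_cast k.factorial_pos
  have : Nonempty A := hA.to_subtype
  refine le_of_mul_le_mul_left ?_ hk
  rw [factorial_mul_sum_dppWeight_subset]
  have h1 := sum_det_submatrix_sq (Vk.submatrix (Subtype.val : A → Fin d) id)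
  have h2 := sum_injective_adjugate_sq (Vk.submatrix (Subtype.val : A → Fin d) id)
  rw [Fintype.card_fin] at h1 h2
  rw [Fintype.card_coe] at h2
  calc _ ≤ ∑ f : Fin k → A,
        (a * ((Vk.submatrix (Subtype.val : A → Fin d) id).submatrix f id).det ^ 2 +
          b * if Function.Injective f then ∑ j, ∑ l,
            ((Vk.submatrix (Subtype.val : A → Fin d) id).submatrix f id).adjugate l j ^ 2
            else 0) := by
        refine Finset.sum_le_sum fun f _ => ?_
        have h3 := h fun i => (f i : Fin d)
        have h4 : Function.Injective (fun i => (f i : Fin d)) ↔ Function.Injective f :=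
          Subtype.val_injective.of_comp_iff f
        rw [if_congr h4 rfl rfl] at h3
        rw [mul_ite, mul_zero]
        exact h3
    _ = _ := by
        rw [Finset.sum_add_distrib, ← Finset.mul_sum, ← Finset.mul_sum, h1, h2, rowGram]
        ring

/-- Bessel's inequality for a standard basis vector. -/
theorem leverage_le_one (hV : Vkᵀ * Vk = 1) (j : Fin d) : leverage Vk j ≤ 1 := by
  have h := projection_diag_le hV (1 : Matrix (Fin d) (Fin d) ℝ) j
  rw [transpose_mul_self_apply_self, Matrix.mul_one, Matrix.transpose_one, Matrix.one_mul,
    Matrix.one_apply_eq] at h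
  exact h

theorem trace_rowGram (Vk : Matrix (Fin d) (Fin k) ℝ) (A : Finset (Fin d)) :
    (rowGram Vk A).trace = ∑ j ∈ A, leverage Vk j := by
  rw [rowGram, trace_transpose_mul_self, Finset.sum_comm]
  exact Finset.sum_coe_sort A (fun j => leverage Vk j)

theorem sum_leverage (hV : Vkᵀ * Vk = 1) : ∑ j, leverage Vk j = k := by
  have h := congrArg Matrix.trace hV
  rw [trace_transpose_mul_self, Finset.sum_comm, Matrix.trace_one, Fintype.card_fin] at h
  exact h

/-- The infimum is attained because `q = d` is admissible: the leverage scores sum to `k` and `1 / θ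
≤ 1`. An empty set would give the default value `0`. -/
theorem pEff_spec (hV : Vkᵀ * Vk = 1) (hd : 1 ≤ d) (π : Equiv.Perm (Fin d)) {θ : ℝ}
    (hθ : 1 < θ) : 1 ≤ pEff Vk π θ ∧ pEff Vk π θ ≤ d ∧
      (k : ℝ) - 1 + 1 / θ ≤ ∑ i : Fin d with i.val < pEff Vk π θ, leverage Vk (π i) := by
  refine Nat.sInf_mem (s := {q : ℕ | 1 ≤ q ∧ q ≤ d ∧
    (k : ℝ) - 1 + 1 / θ ≤ ∑ i : Fin d with i.val < q, leverage Vk (π i)}) ⟨d, hd, le_rfl, ?_⟩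
  have h1 : ∑ i : Fin d with i.val < d, leverage Vk (π i) = k := by
    rw [Finset.filter_true_of_mem fun i _ => i.2, Equiv.sum_comp π (leverage Vk),
      sum_leverage hV]
  have h2 : 1 / θ ≤ 1 := by
    rw [div_le_one (by linarith)]
    exact hθ.le
  rw [h1]
  linarith

theorem compl_tailSet (π : Equiv.Perm (Fin d)) (q : ℕ) :
    (tailSet π q)ᶜ = (Finset.univ.filter fun i : Fin d => i.val < q).map π.toEmbedding := by
  ext j
  simp only [tailSet, Finset.mem_compl, Finset.mem_image, Finset.mem_filter, Finset.mem_univ,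
    true_and, Finset.mem_map, Equiv.coe_toEmbedding, not_exists, not_and]
  constructor
  · intro h
    refine ⟨π.symm j, ?_, by simp⟩
    by_contra hlt
    exact h (π.symm j) (by omega) (by simp)
  · rintro ⟨i, hi, rfl⟩ a ha hai
    have := π.injective hai
    subst this
    omega

theorem card_compl_tailSet (π : Equiv.Perm (Fin d)) {q : ℕ} (hq : q ≤ d) :
    (tailSet π q)ᶜ.card = q := by
  rw [compl_tailSet, Finset.card_map]
  simp [Fin.card_filter_val_lt, hq]

theorem avoidEvent_eq (Vk : Matrix (Fin d) (Fin k) ℝ) (π : Equiv.Perm (Fin d)) (θ : ℝ) :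
    avoidEvent Vk π θ = {S | S ⊆ (tailSet π (pEff Vk π θ))ᶜ} := by
  ext S
  simp only [avoidEvent, Set.mem_ofPred_eq]
  rw [← Finset.disjoint_iff_inter_eq_empty, Finset.subset_compl_iff_disjoint_right]

theorem dpp_avoidEvent_bounds (hV : Vkᵀ * Vk = 1) (hd : 1 ≤ d) (π : Equiv.Perm (Fin d)) {θ : ℝ}
    (hθ : 1 < θ) :
    1 / θ ≤ (rowGram Vk (tailSet π (pEff Vk π θ))ᶜ).det ∧
      (rowGram Vk (tailSet π (pEff Vk π θ))ᶜ).adjugate.trace ≤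
        ((k : ℝ) - 1 + θ) * (rowGram Vk (tailSet π (pEff Vk π θ))ᶜ).det := by
  obtain ⟨-, -, h⟩ := pEff_spec hV hd π hθ
  have h1 := det_and_trace_adjugate_bound (G := rowGram Vk (tailSet π (pEff Vk π θ))ᶜ)
    (Matrix.posSemidef_conjTranspose_mul_self _) (posSemidef_one_sub_gram Vk hV _) hθ
  rw [Fintype.card_fin] at h1
  refine h1 ?_
  rw [trace_rowGram, compl_tailSet, Finset.sum_map]
  exact h

/-- Scores are at most `1`, so more than `k - 1` of them are needed to reach `k - 1 + 1/θ`. -/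
theorem le_pEff (hV : Vkᵀ * Vk = 1) (hd : 1 ≤ d) (π : Equiv.Perm (Fin d)) {θ : ℝ}
    (hθ : 1 < θ) : 0 ≤ (pEff Vk π θ : ℝ) - k + 1 := by
  obtain ⟨-, hle, h⟩ := pEff_spec hV hd π hθ
  have h1 : ∑ i : Fin d with i.val < pEff Vk π θ, leverage Vk (π i) ≤ pEff Vk π θ := by
    refine (Finset.sum_le_card_nsmul _ _ 1 fun i _ => leverage_le_one hV _).trans ?_
    have hc := card_compl_tailSet π hle
    rw [compl_tailSet, Finset.card_map] at hc
    rw [hc]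
    simp
  have h2 : 0 < 1 / θ := by positivity
  linarith

/-- The bound for a conditional expectation given that the tail is avoided. -/
theorem integral_cond_avoidEvent_le (hV : Vkᵀ * Vk = 1) (hd : 1 ≤ d) (π : Equiv.Perm (Fin d))
    {θ : ℝ} (hθ : 1 < θ) {φ : Finset (Fin d) → ℝ} {a b : ℝ} (hb : 0 ≤ b)
    (h : ∀ f : Fin k → Fin d, (Vk.submatrix f id).det ^ 2 * φ (Finset.univ.image f) ≤
      a * (Vk.submatrix f id).det ^ 2 + if Function.Injective f then
        b * ∑ j, ∑ l, (Vk.submatrix f id).adjugate l j ^ 2 else 0) :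
    ∫ S, φ S ∂ProbabilityTheory.cond (dpp Vk) (avoidEvent Vk π θ) ≤
      a + b * (((pEff Vk π θ : ℝ) - k + 1) * (k - 1 + θ)) := by
  obtain ⟨h1, h2⟩ := dpp_avoidEvent_bounds hV hd π hθ
  obtain ⟨hp1, hpd, -⟩ := pEff_spec hV hd π hθ
  have hcard := card_compl_tailSet π hpd
  have hA : (tailSet π (pEff Vk π θ))ᶜ.Nonempty := by
    rw [← Finset.card_pos]
    omega
  have h3 := sum_dppWeight_subset_le hA h
  rw [avoidEvent_eq, integral_cond_dpp_subset, dpp_real_subset_eq_det]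
  rw [hcard] at h3
  -- This determinant is the probability of the event, so the conditioning is not degenerate.
  have hD : 0 < (rowGram Vk (tailSet π (pEff Vk π θ))ᶜ).det :=
    lt_of_lt_of_le (by positivity) h1
  rw [inv_mul_le_iff₀ hD]
  refine h3.trans ?_
  have h4 := mul_le_mul_of_nonneg_left (mul_le_mul_of_nonneg_left h2 (le_pEff hV hd π hθ)) hb
  linarith

end ProjectionProcess

/-! ### The flatness parameter and the final assembly. -/

theorem flatness_mul_sum_tail {r d k : ℕ} (σ : Fin r → ℝ) (hσ : ∀ i, 0 < σ i) (hr : k < r)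
    (hd : r ≤ d) :
    flatness d k σ * ∑ j : Fin r with k ≤ j.val, σ j ^ 2 =
      nextSingular k σ ^ 2 * ((d : ℝ) - k) := by
  have h1 : 0 < ∑ j : Fin r with k ≤ j.val, σ j ^ 2 :=
    Finset.sum_pos (fun j _ => pow_pos (hσ j) 2) ⟨⟨k, hr⟩, by simp⟩
  have h2 : (0 : ℝ) < (d : ℝ) - k := by
    have : (k : ℝ) < d := by exact_mod_cast hr.trans_le hd
    linarith
  rw [flatness, dif_pos hr, nextSingular, dif_pos hr]
  field_simp

theorem IsThinSVD.le_cols {N d r : ℕ} {X : Matrix (Fin N) (Fin d) ℝ}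
    {U : Matrix (Fin N) (Fin r) ℝ} {σ : Fin r → ℝ} {V : Matrix (Fin d) (Fin r) ℝ}
    (hX : IsThinSVD X U σ V) : r ≤ d := by
  have h := Matrix.rank_mul_le_right Vᵀ V
  rw [hX.orthV, Matrix.rank_one, Fintype.card_fin] at h
  simpa using h.trans (Matrix.rank_le_card_height V)

end ColumnSubset

theorem mainTheorem3 {N d r k : ℕ} (X : Matrix (Fin N) (Fin d) ℝ)
    (U : Matrix (Fin N) (Fin r) ℝ) (σ : Fin r → ℝ) (V : Matrix (Fin d) (Fin r) ℝ)
    (hX : IsThinSVD X U σ V) (hk : 1 ≤ k) (hkr : k ≤ r)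
    (π : Equiv.Perm (Fin d))
    (hπ : Antitone fun i => leverage (firstCols hkr V) (π i))
    (θ : ℝ) (hθ : 1 < θ) :
    1 / θ ≤ (dpp (firstCols hkr V)).real
        (avoidEvent (firstCols hkr V) π θ) ∧
    ∫ S, matNorm .spectral (X - colProj .spectral X S) ^ 2
        ∂(ProbabilityTheory.cond (dpp (firstCols hkr V))
          (avoidEvent (firstCols hkr V) π θ)) ≤
      ((pEff (firstCols hkr V) π θ : ℝ) - k + 1) * (k - 1 + θ) *
        matNorm .spectral (X - bestRank .spectral k X) ^ 2 ∧
    ∫ S, matNorm .frobenius (X - colProj .frobenius X S) ^ 2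
        ∂(ProbabilityTheory.cond (dpp (firstCols hkr V))
          (avoidEvent (firstCols hkr V) π θ)) ≤
      (1 + flatness d k σ *
          (((pEff (firstCols hkr V) π θ : ℝ) + 1 - k) / (d - k)) *
          (k - 1 + θ)) *
        matNorm .frobenius (X - bestRank .frobenius k X) ^ 2 := by
  have hV := firstCols_orth hkr hX.orthV
  have hrd := hX.le_cols
  have hd : 1 ≤ d := hk.trans (hkr.trans hrd)
  have hE := residual_mul_firstCols (U := U) (σ := σ) hkr hX.orthV
  have hXE := hX.eq_add_residual hkr
  have hs0 : 0 ≤ nextSingular k σ := nextSingular_nonneg hX.pos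
  have hk1 : (1 : ℝ) ≤ k := by exact_mod_cast hk
  have hp := le_pEff hV hd π hθ
  have hspec : spectralNorm (residual k U σ V) ^ 2 ≤ nextSingular k σ ^ 2 :=
    pow_le_pow_left₀ (spectralNorm_nonneg _) hX.spectralNorm_residual_le 2
  have hq : 0 ≤ ((pEff (firstCols hkr V) π θ : ℝ) - k + 1) * (k - 1 + θ) :=
    mul_nonneg hp (by linarith)
  refine ⟨?_, ?_, ?_⟩
  · rw [avoidEvent_eq, dpp_real_subset_eq_det]
    exact (dpp_avoidEvent_bounds hV hd π hθ).1
  · refine (integral_cond_avoidEvent_le hV hd π hθ (a := 0)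
      (b := spectralNorm (residual k U σ V) ^ 2) (sq_nonneg _) fun f => ?_).trans ?_
    · rw [zero_mul, zero_add]
      exact det_sq_mul_spectral_loss_le hk hV hE hXE
    · have h1 := hX.nextSingular_le (exists_bestRank .spectral k X).choose_spec.1
      rw [zero_add, mul_comm]
      refine mul_le_mul_of_nonneg_left ?_ hq
      exact hspec.trans (pow_le_pow_left₀ hs0 h1 2)
  · have h1 := hX.sum_tail_le hkr (exists_bestRank .frobenius k X).choose_spec.1
    refine (integral_cond_avoidEvent_le hV hd π hθ
      (a := frobeniusNorm (residual k U σ V) ^ 2)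
      (b := spectralNorm (residual k U σ V) ^ 2) (sq_nonneg _) fun f =>
        det_sq_mul_frobenius_loss_le hV hE hXE).trans ?_
    have h2 := mul_le_mul_of_nonneg_right hspec hq
    rw [hX.frobeniusNorm_residual_sq]
    refine (add_le_add le_rfl h2).trans ?_
    rcases hkr.lt_or_eq with hr | hr
    · have hdk : (0 : ℝ) < (d : ℝ) - k := by
        have : (k : ℝ) < d := by exact_mod_cast hr.trans_le hrd
        linarith
      have h3 := flatness_mul_sum_tail σ hX.pos hr hrd
      have hβ : 0 ≤ flatness d k σ := by
        unfold flatness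
        split_ifs <;> positivity
      have hc : 0 ≤ 1 + flatness d k σ *
          (((pEff (firstCols hkr V) π θ : ℝ) + 1 - k) / (d - k)) * (k - 1 + θ) := by
        have h5 : 0 ≤ ((pEff (firstCols hkr V) π θ : ℝ) + 1 - k) / (d - k) :=
          div_nonneg (by linarith) hdk.le
        have h6 : 0 ≤ (k : ℝ) - 1 + θ := by linarith
        positivity
      -- Once the Frobenius tail stands in for the best approximation error, the bound is an
      -- identity, by the definition of `β`.
      refine le_trans (le_of_eq ?_) (mul_le_mul_of_nonneg_left h1 hc)
      have h4 : (1 + flatness d k σ *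
          (((pEff (firstCols hkr V) π θ : ℝ) + 1 - k) / (d - k)) * (k - 1 + θ)) *
            (∑ j : Fin r with k ≤ j.val, σ j ^ 2) = (∑ j : Fin r with k ≤ j.val, σ j ^ 2) +
          (flatness d k σ * ∑ j : Fin r with k ≤ j.val, σ j ^ 2) *
            (((pEff (firstCols hkr V) π θ : ℝ) + 1 - k) / (d - k) * (k - 1 + θ)) := by
        ring
      rw [h4, h3]
      field_simp
      ring
    -- For `r = k` the `else` branch makes `flatness` vanish, so the quotient by `d - k`, which may
    -- be `0`, plays no role.
    · have h3 : nextSingular k σ = 0 := by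
        rw [nextSingular, dif_neg (by omega)]
      have h4 : flatness d k σ = 0 := by
        rw [flatness, dif_neg (by omega), zero_mul]
      rw [h3, h4]
      simp only [zero_mul, add_zero, one_mul, ne_eq, OfNat.ofNat_ne_zero, not_false_eq_true,
        zero_pow]
      exact h1
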